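/- Let $F$ be a field of characteristic $p>0$, let $E/F$ be a finite-dimensional purely inseparable field extension of exponent one, and let $\delta$ be a derivation of $E$ with $\mathrm{Const}(\delta)=\{a\in E\mid\delta(a)=0\}=F$ whose minimal polynomial over $F$ is $t^p-t$. Let $D$ be a finite-dimensional associative division algebra over $F$ with centre $F$ such that $D_E=D\otimes_F E$ is a division algebra, and extend $\delta$ to $D_E$ by $\delta(b\otimes a)=b\otimes\delta(a)$, so that $\delta|_D=0$. For an associative ring $A$ with a derivation $\delta$, let $A[t;\delta]$ be the differential polynomial ring (polynomials with coefficients on the left and $ta=at+\delta(a)$). For monic $f\in A[t;\delta]$ of degree $m$, $A[t;\delta]/A[t;\delta]f$ denotes the nonassociative (that is, not necessarily associative) algebra of all polynomials of degree less than $m$ with the multiplication $g\circ h=gh \bmod_r f$, where $\bmod_r f$ is the remainder of right division by $f$ ($g=qf+r$, $\deg r<m$). For $z\in D_E$ let $V_p(z)\in D_E$ be the element with $(t-z)^p=t^p-V_p(z)$ in $D_E[t;\delta]$. A nonassociative algebra is a division algebra if it is nonzero and left and right multiplication by each nonzero element are bijective. Let $d\in E$, $f(t)=t^p-t-d$ and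 $(E,\delta,d)=E[t;\delta]/E[t;\delta]f(t)$. Then: (1) There is an isomorphism of $F$-algebras $$(E,\delta,d)\otimes_F D\;\cong\; D_E[t;\delta]/D_E[t;\delta]f(t),$$ given by $at^i\otimes b\mapsto (b\otimes a)t^i$ for $a\in E$, $b\in D$, $0\le i<p$. (2) $(E,\delta,d)\otimes_F D$ has dimension $p^2[D:F]$ over $F$, and it is a division algebra if and only if $d\neq V_p(z)-z$ for all $z\in D_E$; equivalently, if and only if $d\neq t^p-(t-z)^p-z$ for all $z\in D_E$. (3) Under the isomorphism in (1), the map $G=G_{\mathrm{id},-1}:\sum_{i<p}a_it^i\mapsto\sum_{i<p}a_i(t-1)^i$ ($a_i\in D_E$) is an $F$-algebra automorphism of $(E,\delta,d)\otimes_F D$ which is the identity on $D$ and generates a cyclic subgroup of order $p$ of $\mathrm{Aut}_F((E,\delta,d)\otimes_F D)$. -/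

import Mathlib

open scoped Polynomial
open scoped TensorProduct

noncomputable section

/-- An `F`-linear derivation of a (not necessarily commutative) `F`-algebra `A`. -/
structure NCDerivation (F A : Type*) [CommRing F] [Ring A] [Algebra F A] extends A →ₗ[F] A where
  leibniz' : ∀ a b : A, toFun (a * b) = a * toFun b + toFun a * b

/-- A derivation of a commutative algebra, viewed as an `NCDerivation`. -/
def Derivation.toNC {F E : Type*} [CommRing F] [CommRing E] [Algebra F E]
    (δ : Derivation F E E) : NCDerivation F E where
  toLinearMap := δ.toLinearMap
  leibniz' a b := by
    change δ (a * b) = a * δ b + δ a * b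
    rw [δ.leibniz, smul_eq_mul, smul_eq_mul, mul_comm b]

/-- The extension of a derivation `δ` of `E` to `D_E = D ⊗ E` which vanishes on `D`:
it sends `b ⊗ a` to `b ⊗ δ a`. -/
def Derivation.extendNC {F E : Type*} [CommRing F] [CommRing E] [Algebra F E]
    (δ : Derivation F E E) (D : Type*) [Ring D] [Algebra F D] :
    NCDerivation F (D ⊗[F] E) where
  toLinearMap := δ.toLinearMap.lTensor D
  leibniz' x y := by
    change δ.toLinearMap.lTensor D (x * y) =
      x * δ.toLinearMap.lTensor D y + δ.toLinearMap.lTensor D x * y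
    induction x with
    | zero => simp
    | add x₁ x₂ h₁ h₂ => rw [add_mul, map_add, h₁, h₂, map_add]; noncomm_ring
    | tmul a e =>
      induction y with
      | zero => simp
      | add y₁ y₂ h₁ h₂ => rw [mul_add, map_add, h₁, h₂, map_add]; noncomm_ring
      | tmul b e' =>
        simp only [Algebra.TensorProduct.tmul_mul_tmul, LinearMap.lTensor_tmul]
        rw [← TensorProduct.tmul_add]
        congr 1
        change δ (e * e') = e * δ e' + δ e * e'
        rw [δ.leibniz, smul_eq_mul, smul_eq_mul, mul_comm e']

section DiffPoly

variable {F A : Type*} [CommRing F] [Ring A] [Algebra F A]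

/-- The differential polynomial ring `A[t;δ]`. Its elements are the polynomials
`a₀ + a₁ t + ⋯ + aₙ tⁿ` with coefficients in `A` on the left, with termwise addition; the
multiplication is the one with `t a = a t + δ a`. -/
def DiffPoly (_δ : NCDerivation F A) : Type _ := A[X]

namespace DiffPoly

variable (δ : NCDerivation F A)

instance : AddCommGroup (DiffPoly δ) := inferInstanceAs (AddCommGroup A[X])
instance : Module F (DiffPoly δ) := inferInstanceAs (Module F A[X])

/-- Left multiplication by `t` : `a tⁱ ↦ a tⁱ⁺¹ + δ(a) tⁱ`. -/
def tMul : Module.End F A[X] :=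
  Polynomial.lsum fun i =>
    (Polynomial.monomial (i + 1) : A →ₗ[A] A[X]).restrictScalars F +
      ((Polynomial.monomial i : A →ₗ[A] A[X]).restrictScalars F) ∘ₗ δ.toLinearMap

/-- The multiplication `(∑ aᵢ tⁱ) g = ∑ aᵢ (tⁱ g)` of `A[t;δ]`. -/
def mulHom : A[X] →ₗ[F] Module.End F A[X] :=
  Polynomial.lsum fun i =>
    (LinearMap.mulRight F (tMul δ ^ i)) ∘ₗ (Algebra.lsmul F F A[X] : A →ₐ[F] _).toLinearMap

instance : Mul (DiffPoly δ) := ⟨fun f g => mulHom δ f g⟩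
instance : One (DiffPoly δ) := ⟨(1 : A[X])⟩

/-- The constant polynomial `a`. -/
def C (a : A) : DiffPoly δ := Polynomial.C a

/-- The indeterminate. -/
def t : DiffPoly δ := (Polynomial.X : A[X])

theorem tMul_monomial (i : ℕ) (a : A) : tMul δ (Polynomial.monomial i a) =
    Polynomial.monomial (i + 1) a + Polynomial.monomial i (δ.toLinearMap a) := by
  simp [tMul, Polynomial.lsum_apply, Polynomial.sum_monomial_index]

theorem mulHom_monomial (i : ℕ) (a : A) (g : A[X]) :
    mulHom δ (Polynomial.monomial i a) g = a • (tMul δ ^ i) g := by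
  simp [mulHom, Polynomial.lsum_apply, Polynomial.sum_monomial_index]

theorem deriv_one : δ.toLinearMap 1 = 0 := by
  have h := δ.leibniz' 1 1
  change δ.toLinearMap (1 * 1) = 1 * δ.toLinearMap 1 + δ.toLinearMap 1 * 1 at h
  simpa using h

theorem deriv_mul (a b : A) :
    δ.toLinearMap (a * b) = a * δ.toLinearMap b + δ.toLinearMap a * b := δ.leibniz' a b

theorem tMul_pow_one (i : ℕ) : (tMul δ ^ i) (1 : A[X]) = Polynomial.monomial i 1 := by
  induction i with
  | zero => simp
  | succ i ih => rw [pow_succ', Module.End.mul_apply, ih, tMul_monomial, deriv_one]; simp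

theorem tMul_smul (a : A) (g : A[X]) :
    tMul δ (a • g) = a • tMul δ g + δ.toLinearMap a • g := by
  induction g using Polynomial.induction_on' with
  | add p q hp hq => rw [smul_add, map_add, hp, hq, map_add, smul_add, smul_add]; abel
  | monomial n b =>
    rw [Polynomial.smul_monomial, tMul_monomial, tMul_monomial, smul_add,
      Polynomial.smul_monomial, Polynomial.smul_monomial, Polynomial.smul_monomial, smul_eq_mul,
      smul_eq_mul, smul_eq_mul, deriv_mul, map_add, add_assoc]

theorem mulHom_smul (a : A) (f g : A[X]) : mulHom δ (a • f) g = a • mulHom δ f g := by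
  induction f using Polynomial.induction_on' with
  | add p q hp hq => rw [smul_add, map_add, map_add, LinearMap.add_apply, hp, hq,
      LinearMap.add_apply, smul_add]
  | monomial n b =>
    rw [Polynomial.smul_monomial, mulHom_monomial, mulHom_monomial, smul_smul, smul_eq_mul]

theorem mulHom_tMul (f g : A[X]) : mulHom δ (tMul δ f) g = tMul δ (mulHom δ f g) := by
  induction f using Polynomial.induction_on' with
  | add p q hp hq => simp only [map_add, LinearMap.add_apply, hp, hq]
  | monomial n b =>
    rw [tMul_monomial, map_add, LinearMap.add_apply, mulHom_monomial, mulHom_monomial,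
      mulHom_monomial, tMul_smul, pow_succ', Module.End.mul_apply]

theorem mulHom_tMul_pow (i : ℕ) (f g : A[X]) :
    mulHom δ ((tMul δ ^ i) f) g = (tMul δ ^ i) (mulHom δ f g) := by
  induction i with
  | zero => simp
  | succ i ih => rw [pow_succ', Module.End.mul_apply, mulHom_tMul, ih, Module.End.mul_apply]

theorem mulHom_assoc (f g h : A[X]) :
    mulHom δ (mulHom δ f g) h = mulHom δ f (mulHom δ g h) := by
  induction f using Polynomial.induction_on' with
  | add p q hp hq => simp only [map_add, LinearMap.add_apply, hp, hq]
  | monomial n b => rw [mulHom_monomial, mulHom_monomial, mulHom_smul, mulHom_tMul_pow]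

theorem mulHom_one (f : A[X]) : mulHom δ f 1 = f := by
  induction f using Polynomial.induction_on' with
  | add p q hp hq => rw [map_add, LinearMap.add_apply, hp, hq]
  | monomial n b =>
    rw [mulHom_monomial, tMul_pow_one, Polynomial.smul_monomial, smul_eq_mul, mul_one]

theorem one_mulHom (f : A[X]) : mulHom δ 1 f = f := by
  rw [← Polynomial.monomial_zero_one, mulHom_monomial]
  simp

instance : Ring (DiffPoly δ) :=
  { (inferInstance : AddCommGroup (DiffPoly δ)) with
    mul := (· * ·)
    one := 1
    mul_assoc := mulHom_assoc δ
    one_mul := one_mulHom δ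
    mul_one := mulHom_one δ
    left_distrib := fun f g h => map_add (mulHom δ f) g h
    right_distrib := fun f g h => LinearMap.congr_fun (map_add (mulHom δ) f g) h
    zero_mul := fun f => LinearMap.congr_fun (map_zero (mulHom δ)) f
    mul_zero := fun f => map_zero (mulHom δ f) }

instance : Algebra F (DiffPoly δ) :=
  Algebra.ofModule
    (fun c f g => LinearMap.congr_fun (map_smul (mulHom δ) c f) g)
    (fun c f g => map_smul (mulHom δ f) c g)

theorem C_mul_C (a b : A) : C δ a * C δ b = C δ (a * b) := by
  change mulHom δ (Polynomial.C a) (Polynomial.C b) = Polynomial.C (a * b)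
  rw [← Polynomial.monomial_zero_left, mulHom_monomial, pow_zero, Module.End.one_apply,
    Polynomial.smul_C, smul_eq_mul]

theorem t_mul (g : DiffPoly δ) : t δ * g = tMul δ g := by
  have h : ∀ q : A[X], mulHom δ Polynomial.X q = tMul δ q := fun q => by
    rw [← Polynomial.monomial_one_one_eq_X, mulHom_monomial, one_smul, pow_one]
  exact h g

theorem t_pow (n : ℕ) : t δ ^ n = (Polynomial.X ^ n : A[X]) := by
  induction n with
  | zero => rw [pow_zero, pow_zero]; rfl
  | succ n ih =>
    have h : tMul δ (Polynomial.X ^ n : A[X]) = Polynomial.X ^ (n + 1) := by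
      rw [← Polynomial.monomial_one_right_eq_X_pow, tMul_monomial, deriv_one,
        ← Polynomial.monomial_one_right_eq_X_pow]
      simp
    rw [pow_succ', t_mul, ih]
    exact h

theorem C_mul_t_pow (n : ℕ) (a : A) : C δ a * t δ ^ n = Polynomial.monomial n a := by
  rw [t_pow]
  change mulHom δ (Polynomial.C a) _ = _
  rw [← Polynomial.monomial_zero_left, mulHom_monomial, pow_zero, Module.End.one_apply,
    ← Polynomial.monomial_one_right_eq_X_pow, Polynomial.smul_monomial, smul_eq_mul, mul_one]

/-- The defining relation `t a = a t + δ a`. -/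
theorem t_mul_C (a : A) : t δ * C δ a = C δ a * t δ + C δ (δ.toLinearMap a) := by
  have h := C_mul_t_pow δ 1 a
  rw [pow_one] at h
  rw [h, t_mul]
  exact tMul_monomial δ 0 a

variable {δ}

/-- The coefficient of `tⁿ` (coefficients on the left). -/
def coeff (f : DiffPoly δ) (n : ℕ) : A := Polynomial.coeff (R := A) f n

/-- The degree (with `natDeg 0 = 0`). -/
def natDeg (f : DiffPoly δ) : ℕ := Polynomial.natDegree (R := A) f

/-- The leading coefficient is `1`. -/
def Monic (f : DiffPoly δ) : Prop := Polynomial.Monic (R := A) f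

/-- The submodule `R_m` of the differential polynomials of degree less than `m`. -/
def degLT (δ : NCDerivation F A) (m : ℕ) : Submodule F (DiffPoly δ) :=
  (Polynomial.degreeLT A m).restrictScalars F

theorem mem_degLT {m : ℕ} {f : DiffPoly δ} :
    f ∈ degLT δ m ↔ ∀ k, m ≤ k → coeff f k = 0 := by
  have h : ∀ q : A[X], q ∈ Polynomial.degreeLT A m ↔ ∀ k, m ≤ k → q.coeff k = 0 := fun q => by
    rw [Polynomial.mem_degreeLT, Polynomial.degree_lt_iff_coeff_zero]
  exact h f

theorem coeff_tMul_succ (g : A[X]) (k : ℕ) : (tMul δ g).coeff (k + 1) =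
    g.coeff k + δ.toLinearMap (g.coeff (k + 1)) := by
  induction g using Polynomial.induction_on' with
  | add p q hp hq => simp only [map_add, Polynomial.coeff_add, hp, hq]; abel
  | monomial n b =>
    rw [tMul_monomial, Polynomial.coeff_add, Polynomial.coeff_monomial, Polynomial.coeff_monomial,
      Polynomial.coeff_monomial, Polynomial.coeff_monomial]
    congr 1
    · simp
    · split_ifs <;> simp

theorem tMul_pow_top (f : A[X]) (m : ℕ) (hm : f.coeff m = 1)
    (hf : ∀ k, m < k → f.coeff k = 0) (i : ℕ) :
    ((tMul δ ^ i) f).coeff (m + i) = 1 ∧ ∀ k, m + i < k → ((tMul δ ^ i) f).coeff k = 0 := by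
  induction i with
  | zero => exact ⟨by simpa using hm, by simpa using hf⟩
  | succ i ih =>
    rw [pow_succ', Module.End.mul_apply]
    constructor
    · rw [← add_assoc, coeff_tMul_succ, ih.1, ih.2 _ (Nat.lt_succ_self _), map_zero, add_zero]
    · intro k hk
      obtain ⟨k, rfl⟩ : ∃ j, k = j + 1 := ⟨k - 1, by omega⟩
      rw [coeff_tMul_succ, ih.2 _ (by omega), ih.2 _ (by omega), map_zero, add_zero]

theorem mulHom_top (f : A[X]) (m : ℕ) (hm : f.coeff m = 1)
    (hf : ∀ k, m < k → f.coeff k = 0) (q : A[X]) (n : ℕ) (hq : ∀ k, n < k → q.coeff k = 0) :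
    (mulHom δ q f).coeff (m + n) = q.coeff n := by
  have hsum : mulHom δ q f = ∑ i ∈ Finset.range (n + 1), q.coeff i • (tMul δ ^ i) f := by
    have hn : q.natDegree < n + 1 :=
      Nat.lt_succ_of_le (Polynomial.natDegree_le_iff_coeff_eq_zero.2 fun k hk => hq k hk)
    conv_lhs => rw [Polynomial.as_sum_range' q (n + 1) hn]
    rw [map_sum, LinearMap.sum_apply]
    exact Finset.sum_congr rfl fun i _ => mulHom_monomial δ i _ f
  rw [hsum, Polynomial.finsetSum_coeff, Finset.sum_range_succ, Finset.sum_eq_zero, zero_add,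
    Polynomial.coeff_smul, (tMul_pow_top f m hm hf n).1, smul_eq_mul, mul_one]
  intro i hi
  rw [Polynomial.coeff_smul, (tMul_pow_top f m hm hf i).2 _ (by
    have := Finset.mem_range.1 hi; omega), smul_zero]

/-- Existence and uniqueness of the remainder of right division by a monic `f`. -/
theorem existsUnique_rem (f : DiffPoly δ) (hf : f.Monic) (g : DiffPoly δ) :
    ∃! r : DiffPoly δ, r ∈ degLT δ f.natDeg ∧ ∃ q : DiffPoly δ, g = q * f + r := by
  have hm : Polynomial.coeff (R := A) f f.natDeg = 1 := hf
  have htop : ∀ k, f.natDeg < k → Polynomial.coeff (R := A) f k = 0 := fun k hk =>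
    Polynomial.coeff_eq_zero_of_natDegree_lt hk
  have hex : ∀ (n : ℕ) (g : DiffPoly δ), g ∈ degLT δ (f.natDeg + n) →
      ∃ r : DiffPoly δ, r ∈ degLT δ f.natDeg ∧ ∃ q : DiffPoly δ, g = q * f + r := by
    intro n
    induction n with
    | zero => exact fun g hg => ⟨g, hg, 0, by rw [zero_mul, zero_add]⟩
    | succ n ih =>
      intro g hg
      rw [mem_degLT] at hg
      let a : DiffPoly δ := Polynomial.monomial n (coeff g (f.natDeg + n))
      obtain ⟨r, hr, q, hq⟩ := ih (g - a * f) (by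
        rw [mem_degLT]
        intro k hk
        have h1 : coeff (a * f) k = coeff g (f.natDeg + n) *
            Polynomial.coeff ((tMul δ ^ n) (show A[X] from f)) k := by
          change Polynomial.coeff (mulHom δ (Polynomial.monomial n _) (show A[X] from f)) k = _
          rw [mulHom_monomial, Polynomial.coeff_smul, smul_eq_mul]
        refine (Polynomial.coeff_sub (R := A) g (a * f : DiffPoly δ) k).trans ?_
        refine (congrArg (fun c => coeff g k - c) h1).trans ?_
        rcases hk.eq_or_lt with rfl | hk
        · rw [(tMul_pow_top f _ hm htop n).1, mul_one, sub_self]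
        · rw [(tMul_pow_top f _ hm htop n).2 k hk, mul_zero, sub_zero]
          exact hg k (by omega))
      exact ⟨r, hr, q + a, by rw [add_mul, add_right_comm, ← hq, sub_add_cancel]⟩
  obtain ⟨r, hr, q, hq⟩ := hex (g.natDeg + 1) g (by
    rw [mem_degLT]
    intro k hk
    exact Polynomial.coeff_eq_zero_of_natDegree_lt (R := A)
      (show Polynomial.natDegree (R := A) g < k by change g.natDeg < k; omega))
  refine ⟨r, ⟨hr, q, hq⟩, ?_⟩
  rintro r' ⟨hr', q', hq'⟩
  have key : (q' - q) * f = r - r' := by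
    rw [sub_mul, sub_eq_sub_iff_add_eq_add, ← hq', hq, add_comm]
  have hd : r - r' ∈ degLT δ f.natDeg := Submodule.sub_mem _ hr hr'
  have hz : ∀ n, Polynomial.coeff (R := A) (q' - q) n = 0 := by
    by_contra hne
    have h0 : (show A[X] from (q' - q)) ≠ 0 := fun h => hne fun n => by
      change Polynomial.coeff (show A[X] from (q' - q)) n = 0
      rw [h]; simp
    refine h0 (Polynomial.leadingCoeff_eq_zero.1 ?_)
    have h1 := mulHom_top (δ := δ) f f.natDeg hm htop (show A[X] from (q' - q))
      (Polynomial.natDegree (show A[X] from (q' - q)))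
      (fun k hk => Polynomial.coeff_eq_zero_of_natDegree_lt hk)
    refine h1.symm.trans ?_
    change coeff ((q' - q) * f) _ = 0
    rw [key]
    exact mem_degLT.1 hd _ (by omega)
  have hq0 : q' - q = 0 := Polynomial.ext fun n => (hz n).trans (Polynomial.coeff_zero n).symm
  rw [hq0, zero_mul] at key
  exact (sub_eq_zero.1 key.symm).symm

/-- `g mod_r f`: the remainder of right division of `g` by the monic polynomial `f`, i.e. the
`r` of degree less than `deg f` with `g = q f + r` for some `q`. -/
def modR (f : DiffPoly δ) (hf : f.Monic) (g : DiffPoly δ) : DiffPoly δ :=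
  (existsUnique_rem f hf g).choose

theorem modR_mem (f : DiffPoly δ) (hf : f.Monic) (g : DiffPoly δ) :
    modR f hf g ∈ degLT δ f.natDeg := (existsUnique_rem f hf g).choose_spec.1.1

theorem modR_eq (f : DiffPoly δ) (hf : f.Monic) (g : DiffPoly δ) :
    ∃ q : DiffPoly δ, g = q * f + modR f hf g := (existsUnique_rem f hf g).choose_spec.1.2

theorem modR_unique (f : DiffPoly δ) (hf : f.Monic) (g r q : DiffPoly δ)
    (hr : r ∈ degLT δ f.natDeg) (h : g = q * f + r) : modR f hf g = r :=
  (existsUnique_rem f hf g).unique ⟨modR_mem f hf g, modR_eq f hf g⟩ ⟨hr, q, h⟩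

theorem modR_add (f : DiffPoly δ) (hf : f.Monic) (g h : DiffPoly δ) :
    modR f hf (g + h) = modR f hf g + modR f hf h := by
  obtain ⟨q, hq⟩ := modR_eq f hf g
  obtain ⟨q', hq'⟩ := modR_eq f hf h
  refine modR_unique f hf _ _ (q + q') (Submodule.add_mem _ (modR_mem _ _ _) (modR_mem _ _ _)) ?_
  conv_lhs => rw [hq, hq']
  rw [add_mul]; abel

theorem modR_smul (f : DiffPoly δ) (hf : f.Monic) (c : F) (g : DiffPoly δ) :
    modR f hf (c • g) = c • modR f hf g := by
  obtain ⟨q, hq⟩ := modR_eq f hf g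
  refine modR_unique f hf _ _ (c • q) (Submodule.smul_mem _ _ (modR_mem _ _ _)) ?_
  conv_lhs => rw [hq]
  rw [smul_add, smul_mul_assoc]

theorem modR_zero (f : DiffPoly δ) (hf : f.Monic) : modR f hf 0 = 0 :=
  modR_unique f hf _ _ 0 (Submodule.zero_mem _) (by rw [zero_mul, add_zero])

theorem modR_of_mem (f : DiffPoly δ) (hf : f.Monic) (g : DiffPoly δ)
    (hg : g ∈ degLT δ f.natDeg) : modR f hf g = g :=
  modR_unique f hf _ _ 0 hg (by rw [zero_mul, zero_add])

/-- The element `V_p(b)` of `A` with `(t - b)ᵖ = tᵖ - V_p(b)`, see `sub_C_pow`. -/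
def V (δ : NCDerivation F A) (p : ℕ) (b : A) : A := coeff (t δ ^ p - (t δ - C δ b) ^ p) 0

/-- The map `G_{id,c} : ∑ aᵢ tⁱ ↦ ∑ aᵢ (t + c)ⁱ`. -/
def shift (c : A) (f : DiffPoly δ) : DiffPoly δ :=
  Polynomial.sum (R := A) f fun i a => C δ a * (t δ + C δ c) ^ i

theorem monic_pow_sub (δ : NCDerivation F A) (p : ℕ) (hp : 1 < p) (d : A) :
    (t δ ^ p - t δ - C δ d).Monic := by
  obtain ⟨n, rfl⟩ : ∃ n, p = n + 1 := ⟨p - 1, by omega⟩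
  have h : Polynomial.Monic (Polynomial.X ^ (n + 1) - (Polynomial.X + Polynomial.C d) : A[X]) := by
    refine Polynomial.monic_X_pow_sub ((Polynomial.degree_add_le _ _).trans_lt (max_lt ?_ ?_))
    · exact Polynomial.degree_X_le.trans_lt (by exact_mod_cast hp)
    · exact Polynomial.degree_C_le.trans_lt (by exact_mod_cast Nat.succ_pos n)
  rw [sub_sub, t_pow]
  exact h

/-- The formula `(t - b)ᵖ = tᵖ - V_p(b)` in characteristic `p`. -/
theorem sub_C_pow (δ : NCDerivation F A) (p : ℕ) [hp : Fact p.Prime] [CharP F p] (b : A) :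
    (t δ - C δ b) ^ p = t δ ^ p - C δ (V δ p b) := by
  let S : Module.End F A[X] := LinearMap.mulLeft F Polynomial.X
  let B : Module.End F A[X] := Polynomial.lsum fun i =>
    ((Polynomial.monomial i : A →ₗ[A] A[X]).restrictScalars F) ∘ₗ
      (δ.toLinearMap - LinearMap.mulLeft F b)
  have hS : ∀ i a, S (Polynomial.monomial i a) = Polynomial.monomial (i + 1) a := fun i a => by
    change Polynomial.X * _ = _
    rw [Polynomial.X_mul_monomial]
  have hB : ∀ i a, B (Polynomial.monomial i a) =
      Polynomial.monomial i (δ.toLinearMap a - b * a) := fun i a => by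
    simp [B, Polynomial.lsum_apply, Polynomial.sum_monomial_index]
  have hext : ∀ M N : Module.End F A[X],
      (∀ i a, M (Polynomial.monomial i a) = N (Polynomial.monomial i a)) → M = N := by
    intro M N h
    ext1 f
    induction f using Polynomial.induction_on' with
    | add p q hp hq => rw [map_add, map_add, hp, hq]
    | monomial n a => exact h n a
  have hcomm : Commute S B := hext _ _ fun i a => by
    rw [Module.End.mul_apply, Module.End.mul_apply, hS, hB, hB, hS]
  have hN : mulHom δ (t δ - C δ b) = S + B := hext _ _ fun i a => by
    have h : mulHom δ (Polynomial.X - Polynomial.C b) (Polynomial.monomial i a) =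
        (S + B) (Polynomial.monomial i a) := by
      rw [map_sub, LinearMap.sub_apply, ← Polynomial.monomial_one_one_eq_X,
        ← Polynomial.monomial_zero_left, mulHom_monomial, mulHom_monomial, one_smul, pow_one,
        pow_zero, Module.End.one_apply, tMul_monomial, LinearMap.add_apply, hS, hB,
        Polynomial.smul_monomial, smul_eq_mul, map_sub]
      abel
    exact h
  have hpow : ∀ n : ℕ, (t δ - C δ b) ^ n = ((S + B) ^ n) (1 : A[X]) := by
    intro n
    induction n with
    | zero => rfl
    | succ n ih =>
      rw [pow_succ', pow_succ', Module.End.mul_apply, ← ih, ← hN]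
      rfl
  have hp0 : (p : Module.End F A[X]) = 0 := by
    rw [← map_natCast (algebraMap F (Module.End F A[X])), CharP.cast_eq_zero, map_zero]
  have hSp : ∀ n : ℕ, (S ^ n) (1 : A[X]) = Polynomial.X ^ n := by
    intro n
    induction n with
    | zero => rfl
    | succ n ih => rw [pow_succ', pow_succ', Module.End.mul_apply, ih]; rfl
  have hBp : ∀ n : ℕ, ∃ c : A, (B ^ n) (1 : A[X]) = Polynomial.C c := by
    intro n
    induction n with
    | zero => exact ⟨1, rfl⟩
    | succ n ih =>
      obtain ⟨c, hc⟩ := ih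
      refine ⟨δ.toLinearMap c - b * c, ?_⟩
      rw [pow_succ', Module.End.mul_apply, hc, ← Polynomial.monomial_zero_left,
        ← Polynomial.monomial_zero_left, hB]
  obtain ⟨r, hr⟩ := hcomm.exists_add_pow_prime_eq hp.out
  obtain ⟨c, hc⟩ := hBp p
  have key : (t δ - C δ b) ^ p = t δ ^ p + C δ c := by
    rw [hpow, hr, hp0, zero_mul, zero_mul, zero_mul, add_zero, LinearMap.add_apply, hSp, hc, t_pow]
    rfl
  have hV : V δ p b = -c := by
    unfold V
    rw [key, sub_add_cancel_left]
    exact (Polynomial.coeff_neg (Polynomial.C c) 0).trans (by rw [Polynomial.coeff_C_zero])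
  rw [hV, key]
  have hneg : C δ (-c) = -C δ c := Polynomial.C_neg
  rw [hneg, sub_neg_eq_add]

end DiffPoly

/-- The Petit algebra `S_f = A[t;δ]/A[t;δ]f` of a monic `f` of degree `m`: the differential
polynomials of degree less than `m`, with the multiplication `g ∘ h = g h mod_r f`. -/
def PetitAlgebra {δ : NCDerivation F A} (f : DiffPoly δ) (_hf : f.Monic) : Type _ :=
  DiffPoly.degLT δ f.natDeg

namespace PetitAlgebra

variable {δ : NCDerivation F A} (f : DiffPoly δ) (hf : f.Monic)

instance : AddCommGroup (PetitAlgebra f hf) :=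
  inferInstanceAs (AddCommGroup (DiffPoly.degLT δ f.natDeg))
instance : Module F (PetitAlgebra f hf) :=
  inferInstanceAs (Module F (DiffPoly.degLT δ f.natDeg))

/-- The class of a differential polynomial in `S_f`. -/
def mk (g : DiffPoly δ) : PetitAlgebra f hf := ⟨DiffPoly.modR f hf g, DiffPoly.modR_mem f hf g⟩

variable {f hf}

/-- The representative of degree less than `deg f`. -/
def rep (x : PetitAlgebra f hf) : DiffPoly δ := Subtype.val x

variable (f hf)

instance : Mul (PetitAlgebra f hf) := ⟨fun x y => mk f hf (x.rep * y.rep)⟩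
instance : One (PetitAlgebra f hf) := ⟨mk f hf 1⟩

theorem ext_rep {x y : PetitAlgebra f hf} (h : x.rep = y.rep) : x = y := Subtype.ext h

theorem rep_mul (x y : PetitAlgebra f hf) : (x * y).rep = DiffPoly.modR f hf (x.rep * y.rep) := rfl

theorem modR_rep (x : PetitAlgebra f hf) : DiffPoly.modR f hf x.rep = x.rep :=
  DiffPoly.modR_of_mem f hf _ x.2

theorem rep_one_or : (1 : PetitAlgebra f hf).rep = 1 ∨ Subsingleton (PetitAlgebra f hf) := by
  rcases Nat.eq_zero_or_pos f.natDeg with h | h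
  · right
    refine ⟨fun x y => ext_rep f hf ?_⟩
    have hz : ∀ z : PetitAlgebra f hf, z.rep = 0 := fun z =>
      Polynomial.ext fun n => (DiffPoly.mem_degLT.1 z.2 n (by omega)).trans
        (Polynomial.coeff_zero n).symm
    rw [hz, hz]
  · left
    refine DiffPoly.modR_of_mem f hf _ (DiffPoly.mem_degLT.2 fun k hk => ?_)
    change Polynomial.coeff (1 : A[X]) k = 0
    rw [Polynomial.coeff_one, if_neg (by omega)]

instance : NonAssocRing (PetitAlgebra f hf) :=
  { (inferInstance : AddCommGroup (PetitAlgebra f hf)) with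
    mul := (· * ·)
    one := 1
    left_distrib := fun x y z => ext_rep f hf <|
      (congrArg _ (mul_add x.rep y.rep z.rep)).trans (DiffPoly.modR_add f hf _ _)
    right_distrib := fun x y z => ext_rep f hf <|
      (congrArg _ (add_mul x.rep y.rep z.rep)).trans (DiffPoly.modR_add f hf _ _)
    zero_mul := fun x => ext_rep f hf <|
      (congrArg _ (zero_mul x.rep)).trans (DiffPoly.modR_zero f hf)
    mul_zero := fun x => ext_rep f hf <|
      (congrArg _ (mul_zero x.rep)).trans (DiffPoly.modR_zero f hf)
    one_mul := fun x => by
      rcases rep_one_or f hf with h | h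
      · exact ext_rep f hf (by rw [rep_mul, h, one_mul, modR_rep])
      · exact Subsingleton.elim _ _
    mul_one := fun x => by
      rcases rep_one_or f hf with h | h
      · exact ext_rep f hf (by rw [rep_mul, h, mul_one, modR_rep])
      · exact Subsingleton.elim _ _ }

instance : IsScalarTower F (PetitAlgebra f hf) (PetitAlgebra f hf) :=
  ⟨fun c x y => ext_rep f hf <|
    (congrArg _ (smul_mul_assoc c x.rep y.rep)).trans (DiffPoly.modR_smul f hf _ _)⟩

instance : SMulCommClass F (PetitAlgebra f hf) (PetitAlgebra f hf) :=
  ⟨fun c x y => ext_rep f hf <|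
    ((congrArg _ (mul_smul_comm c x.rep y.rep)).trans (DiffPoly.modR_smul f hf _ _)).symm⟩

end PetitAlgebra

/-- The algebra `(A, δ, d) = A[t;δ]/A[t;δ](tᵖ - t - d)`. -/
abbrev DiffExt (δ : NCDerivation F A) (p : ℕ) [hp : Fact p.Prime] (d : A) : Type _ :=
  PetitAlgebra (DiffPoly.t δ ^ p - DiffPoly.t δ - DiffPoly.C δ d)
    (DiffPoly.monic_pow_sub δ p hp.out.one_lt d)

end DiffPoly

/-- A nonassociative ring is a division algebra if it is nonzero and left and right
multiplication by every nonzero element are bijective. -/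
def IsDivisionAlgebra (A : Type*) [NonUnitalNonAssocRing A] : Prop :=
  Nontrivial A ∧ ∀ a : A, a ≠ 0 →
    Function.Bijective (fun x : A => a * x) ∧ Function.Bijective (fun x : A => x * a)

/-- The group `Aut_F(A)` of `F`-algebra automorphisms of a nonassociative `F`-algebra. -/
def NAAut (F A : Type*) [CommRing F] [NonUnitalNonAssocRing A] [Module F A] :
    Subgroup (A ≃ₗ[F] A) where
  carrier := {g | ∀ x y, g (x * y) = g x * g y}
  mul_mem' := fun {g h} hg hh x y => by
    change g (h (x * y)) = g (h x) * g (h y)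
    rw [hh, hg]
  one_mem' := fun _ _ => rfl
  inv_mem' := fun {g} hg x y => g.injective (by
    change g (g.symm (x * y)) = g (g.symm x * g.symm y)
    rw [hg, LinearEquiv.apply_symm_apply, LinearEquiv.apply_symm_apply,
      LinearEquiv.apply_symm_apply])

end

/-!
Over a finite-dimensional division algebra `A`, the algebra `S_f = A[t;δ]/A[t;δ]f` is a division
algebra precisely when the left ideal generated by `f` is maximal. For if it is maximal and
`x ∘ y = 0` with `y ≠ 0`, then `x`, of degree less than `deg f`, lies in the annihilator of the
class of `y` in the simple module `A[t;δ]/A[t;δ]f`, which has codimension `deg f`, so `x = 0`.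

Let `f = tᵖ - t - d`. It is fixed by the translations `t ↦ t + c` with `c` in the prime field. Let
`h` be the monic generator of a maximal left ideal containing `f`. The intersection of the left
ideals generated by the translates of `h` is generated by a right divisor `u` of `f` that is fixed
by translation. Comparing the coefficients of `tᵐ⁻¹` in `u(t + 1) = u(t)`, where `m = deg u`, gives
`p ∣ m`, so `u = f`. On the other hand `A[t;δ]/⋂ₖ A[t;δ]h(t + k)` has a dimension divisible by
`deg h`, because each successive quotient is zero or isomorphic to `A[t;δ]/A[t;δ]h(t + k)`; hence
`deg h` divides the prime `p`, and either `h = f` or `h = t - z`. Finally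
`f = (t - z)ᵖ - (t - z) + (V_p(z) - z - d)`, so `t - z` divides `f` on the right if and only if
`d = V_p(z) - z`.

The dimension of `E` is `p` because `δ` is diagonalizable with eigenvalues in the prime field, and
each eigenspace is at most one-dimensional: the quotient of two eigenvectors for the same eigenvalue
is a constant.
-/

noncomputable section

namespace DiffPoly

section Coefficients

variable {F A : Type*} [CommRing F] [Ring A] [Algebra F A] {δ : NCDerivation F A}

instance : Module A (DiffPoly δ) := inferInstanceAs (Module A A[X])

instance : IsScalarTower A (DiffPoly δ) (DiffPoly δ) := ⟨mulHom_smul δ⟩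

instance [Nontrivial A] : Nontrivial (DiffPoly δ) := inferInstanceAs (Nontrivial A[X])

/-- The polynomial in a central variable with the same coefficients; only linear over `A`. -/
def toPoly : DiffPoly δ ≃ₗ[A] A[X] := LinearEquiv.refl A A[X]

theorem coeff_toPoly (f : DiffPoly δ) (n : ℕ) : (toPoly f).coeff n = coeff f n := rfl

theorem Monic.coeff_natDeg {f : DiffPoly δ} (hf : f.Monic) : coeff f f.natDeg = 1 := hf

theorem ext_coeff {f g : DiffPoly δ} (h : ∀ n, coeff f n = coeff g n) : f = g :=
  Polynomial.ext h

theorem coeff_add (f g : DiffPoly δ) (n : ℕ) : coeff (f + g) n = coeff f n + coeff g n :=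
  Polynomial.coeff_add (R := A) f g n

theorem coeff_sub (f g : DiffPoly δ) (n : ℕ) : coeff (f - g) n = coeff f n - coeff g n :=
  Polynomial.coeff_sub (R := A) f g n

theorem coeff_smul (a : A) (f : DiffPoly δ) (n : ℕ) : coeff (a • f) n = a * coeff f n :=
  Polynomial.coeff_smul a (show A[X] from f) n

theorem coeff_C (a : A) (n : ℕ) : coeff (C δ a) n = if n = 0 then a else 0 :=
  Polynomial.coeff_C

theorem C_sub (a b : A) : C δ (a - b) = C δ a - C δ b := Polynomial.C_sub

theorem C_neg (a : A) : C δ (-a) = -C δ a := Polynomial.C_neg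

theorem C_one : C δ 1 = 1 := Polynomial.C_1

theorem C_zero : C δ 0 = 0 := Polynomial.C_0

theorem C_injective : Function.Injective (C δ) := Polynomial.C_injective

theorem C_mul (a : A) (f : DiffPoly δ) : C δ a * f = a • f := by
  conv_lhs => rw [← mul_one (C δ a), ← pow_zero (t δ), C_mul_t_pow]
  exact mulHom_monomial δ 0 a f

theorem algebraMap_eq_C (c : F) : algebraMap F (DiffPoly δ) c = C δ (algebraMap F A c) := by
  rw [Algebra.algebraMap_eq_smul_one, Algebra.algebraMap_eq_smul_one, ← C_one]
  exact Polynomial.smul_C c 1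

variable (δ) in
/-- The embedding of the coefficients as constant polynomials. -/
def CHom : A →ₐ[F] DiffPoly δ where
  toFun := C δ
  map_one' := C_one
  map_mul' a b := (C_mul_C δ a b).symm
  map_zero' := C_zero
  map_add' _ _ := Polynomial.C_add
  commutes' c := (algebraMap_eq_C c).symm

theorem CHom_apply (a : A) : CHom δ a = C δ a := rfl

theorem eq_sum {f : DiffPoly δ} {m : ℕ} (hf : f ∈ degLT δ m) :
    f = ∑ i ∈ Finset.range m, C δ (coeff f i) * t δ ^ i := by
  simp only [C_mul_t_pow]
  rcases Nat.eq_zero_or_pos m with rfl | hm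
  · exact ext_coeff fun n => mem_degLT.1 hf n n.zero_le
  · refine Polynomial.as_sum_range' (R := A) f m ?_
    have : f.natDeg ≤ m - 1 := Polynomial.natDegree_le_iff_coeff_eq_zero.2 fun k hk =>
      mem_degLT.1 hf k (by omega)
    exact this.trans_lt (by omega)

theorem mem_degLT_natDeg_add_one (f : DiffPoly δ) : f ∈ degLT δ (f.natDeg + 1) :=
  mem_degLT.2 fun k hk => Polynomial.coeff_eq_zero_of_natDegree_lt (R := A)
    (show Polynomial.natDegree (R := A) f < k from hk)

theorem mem_degLT_of_natDeg_lt {f : DiffPoly δ} {m : ℕ} (h : f.natDeg < m) : f ∈ degLT δ m :=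
  mem_degLT.2 fun k hk => mem_degLT.1 (mem_degLT_natDeg_add_one f) k (by omega)

theorem induction_on {P : DiffPoly δ → Prop} (f : DiffPoly δ)
    (hadd : ∀ f g, P f → P g → P (f + g)) (hmon : ∀ a i, P (C δ a * t δ ^ i)) : P f :=
  Polynomial.induction_on' (R := A) (motive := P) f hadd fun i a => C_mul_t_pow δ i a ▸ hmon a i

theorem toPoly_C_mul_t_pow (a : A) (i : ℕ) :
    toPoly (C δ a * t δ ^ i) = Polynomial.monomial i a := C_mul_t_pow δ i a

theorem toPoly_mul_t (f : DiffPoly δ) : toPoly (f * t δ) = toPoly f * Polynomial.X := by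
  induction f using induction_on with
  | hadd f g hf hg => rw [add_mul, map_add, hf, hg, map_add, add_mul]
  | hmon a i =>
    rw [mul_assoc, ← pow_succ, toPoly_C_mul_t_pow, toPoly_C_mul_t_pow, Polynomial.monomial_mul_X]

theorem algHom_ext {B : Type*} [Ring B] [Algebra F B] {φ ψ : DiffPoly δ →ₐ[F] B}
    (hC : ∀ a, φ (C δ a) = ψ (C δ a)) (ht : φ (t δ) = ψ (t δ)) : φ = ψ := by
  ext f
  induction f using induction_on with
  | hadd f g hf hg => rw [map_add, map_add, hf, hg]
  | hmon a i => rw [map_mul, map_mul, map_pow, map_pow, hC, ht]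

end Coefficients

section UniversalProperty

variable {F A B : Type*} [CommRing F] [Ring A] [Algebra F A] [Ring B] [Algebra F B]
  {δ : NCDerivation F A}

/-- The substitution `∑ aᵢ tⁱ ↦ ∑ φ(aᵢ) yⁱ`, as a linear map. -/
def liftLinear (φ : A →ₐ[F] B) (y : B) : A[X] →ₗ[F] B :=
  Polynomial.lsum fun i => LinearMap.mulRight F (y ^ i) ∘ₗ φ.toLinearMap

theorem liftLinear_monomial (φ : A →ₐ[F] B) (y : B) (i : ℕ) (a : A) :
    liftLinear φ y (Polynomial.monomial i a) = φ a * y ^ i := by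
  simp [liftLinear, Polynomial.lsum_apply, Polynomial.sum_monomial_index]

theorem liftLinear_smul (φ : A →ₐ[F] B) (y : B) (a : A) (g : A[X]) :
    liftLinear φ y (a • g) = φ a * liftLinear φ y g := by
  induction g using Polynomial.induction_on' with
  | add p q hp hq => rw [smul_add, map_add, hp, hq, map_add, mul_add]
  | monomial i b =>
    rw [Polynomial.smul_monomial, liftLinear_monomial, liftLinear_monomial, smul_eq_mul, map_mul,
      mul_assoc]

theorem liftLinear_tMul {φ : A →ₐ[F] B} {y : B}
    (hy : ∀ a, y * φ a = φ a * y + φ (δ.toLinearMap a)) (g : A[X]) :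
    liftLinear φ y (tMul δ g) = y * liftLinear φ y g := by
  induction g using Polynomial.induction_on' with
  | add p q hp hq => rw [map_add, map_add, hp, hq, map_add, mul_add]
  | monomial i b =>
    rw [tMul_monomial, map_add, liftLinear_monomial, liftLinear_monomial, liftLinear_monomial,
      ← mul_assoc, hy, add_mul, pow_succ', mul_assoc]

theorem liftLinear_mulHom {φ : A →ₐ[F] B} {y : B}
    (hy : ∀ a, y * φ a = φ a * y + φ (δ.toLinearMap a)) (f g : A[X]) :
    liftLinear φ y (mulHom δ f g) = liftLinear φ y f * liftLinear φ y g := by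
  have tMul_pow (i : ℕ) : liftLinear φ y ((tMul δ ^ i) g) = y ^ i * liftLinear φ y g := by
    induction i with
    | zero => rw [pow_zero, pow_zero, one_mul, Module.End.one_apply]
    | succ i ih =>
      rw [pow_succ', Module.End.mul_apply, liftLinear_tMul hy, ih, pow_succ', mul_assoc]
  induction f using Polynomial.induction_on' with
  | add p q hp hq => rw [map_add, LinearMap.add_apply, map_add, hp, hq, map_add, add_mul]
  | monomial i b =>
    rw [mulHom_monomial, liftLinear_smul, tMul_pow, liftLinear_monomial, mul_assoc]

variable (δ) in
/-- The universal property of `A[t;δ]`: the homomorphism which is `φ` on the constants and sends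
`t` to an element `y` with `y φ(a) = φ(a) y + φ(δ a)`. -/
def lift (φ : A →ₐ[F] B) (y : B) (hy : ∀ a, y * φ a = φ a * y + φ (δ.toLinearMap a)) :
    DiffPoly δ →ₐ[F] B :=
  AlgHom.ofLinearMap (A := DiffPoly δ) (liftLinear φ y)
    ((liftLinear_monomial φ y 0 1).trans (by rw [map_one, pow_zero, one_mul]))
    (liftLinear_mulHom hy)

theorem lift_apply (φ : A →ₐ[F] B) (y : B)
    (hy : ∀ a, y * φ a = φ a * y + φ (δ.toLinearMap a)) (f : DiffPoly δ) :
    lift δ φ y hy f = Polynomial.sum (R := A) f fun i a => φ a * y ^ i := rfl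

theorem lift_C (φ : A →ₐ[F] B) (y : B)
    (hy : ∀ a, y * φ a = φ a * y + φ (δ.toLinearMap a)) (a : A) :
    lift δ φ y hy (C δ a) = φ a :=
  (liftLinear_monomial φ y 0 a).trans (by rw [pow_zero, mul_one])

theorem lift_t (φ : A →ₐ[F] B) (y : B)
    (hy : ∀ a, y * φ a = φ a * y + φ (δ.toLinearMap a)) :
    lift δ φ y hy (t δ) = y :=
  (liftLinear_monomial φ y 1 1).trans (by rw [map_one, pow_one, one_mul])

end UniversalProperty

section Translation

variable {F A : Type*} [CommRing F] [Ring A] [Algebra F A] {δ : NCDerivation F A}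

variable (δ) in
/-- The translation `∑ aᵢ tⁱ ↦ ∑ aᵢ (t + c)ⁱ` by a constant `c` of the base ring; in the notation
of the paper it is `G_{id,c}`. -/
def translate (c : F) : DiffPoly δ →ₐ[F] DiffPoly δ :=
  lift δ (CHom δ) (t δ + algebraMap F (DiffPoly δ) c) fun a => by
    rw [CHom_apply, CHom_apply, add_mul, mul_add, t_mul_C, Algebra.commutes]
    abel

theorem translate_C (c : F) (a : A) : translate δ c (C δ a) = C δ a := lift_C _ _ _ a

theorem translate_t (c : F) : translate δ c (t δ) = t δ + algebraMap F (DiffPoly δ) c :=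
  lift_t _ _ _

theorem shift_algebraMap (c : F) (f : DiffPoly δ) :
    shift (algebraMap F A c) f = translate δ c f := by
  rw [translate, lift_apply, shift, ← algebraMap_eq_C]
  rfl

theorem translate_comp_translate (c c' : F) :
    (translate δ c).comp (translate δ c') = translate δ (c + c') := by
  refine algHom_ext (fun a => ?_) ?_
  · rw [AlgHom.comp_apply, translate_C, translate_C, translate_C]
  · rw [AlgHom.comp_apply, translate_t, translate_t, map_add, translate_t, AlgHom.commutes,
      map_add, add_assoc]

theorem translate_zero : translate δ (0 : F) = AlgHom.id F (DiffPoly δ) := by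
  refine algHom_ext (fun a => ?_) ?_
  · rw [translate_C, AlgHom.id_apply]
  · rw [translate_t, map_zero, add_zero, AlgHom.id_apply]

variable (δ) in
/-- Translation by `c` as an automorphism of `A[t;δ]`, with inverse the translation by `-c`. -/
def translateEquiv (c : F) : DiffPoly δ ≃ₐ[F] DiffPoly δ :=
  AlgEquiv.ofAlgHom (translate δ c) (translate δ (-c))
    (by rw [translate_comp_translate, add_neg_cancel, translate_zero])
    (by rw [translate_comp_translate, neg_add_cancel, translate_zero])

theorem toPoly_t_add_algebraMap_pow (c : F) (n : ℕ) :
    toPoly ((t δ + algebraMap F (DiffPoly δ) c) ^ n) =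
      (Polynomial.X + Polynomial.C (algebraMap F A c)) ^ n := by
  induction n with
  | zero => rfl
  | succ n ih =>
    have commutes := Algebra.commutes c
      ((Polynomial.X + Polynomial.C (algebraMap F A c)) ^ n : A[X])
    rw [Polynomial.algebraMap_apply] at commutes
    rw [pow_succ, mul_add, map_add, toPoly_mul_t, ← Algebra.commutes, algebraMap_eq_C, C_mul,
      map_smul, ← algebraMap_eq_C, ih, pow_succ, mul_add, ← Polynomial.C_mul', commutes]

theorem toPoly_translate (c : F) (f : DiffPoly δ) :
    toPoly (translate δ c f) = Polynomial.taylor (algebraMap F A c) (toPoly f) := by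
  induction f using induction_on with
  | hadd f g hf hg => rw [map_add, map_add, hf, hg, map_add, map_add]
  | hmon a i =>
    rw [map_mul, map_pow, translate_C, translate_t, C_mul, map_smul, toPoly_t_add_algebraMap_pow,
      toPoly_C_mul_t_pow, Polynomial.taylor_monomial, Polynomial.smul_eq_C_mul]

theorem natDeg_translate (c : F) (f : DiffPoly δ) : (translate δ c f).natDeg = f.natDeg :=
  (congrArg Polynomial.natDegree (toPoly_translate c f)).trans
    (Polynomial.natDegree_taylor (toPoly f) _)

theorem Monic.translate {f : DiffPoly δ} (hf : f.Monic) (c : F) :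
    (DiffPoly.translate δ c f).Monic :=
  (congrArg Polynomial.leadingCoeff (toPoly_translate c f)).trans
    ((Polynomial.leadingCoeff_taylor _ (toPoly f)).trans hf)

theorem translate_mem_degLT {f : DiffPoly δ} {m : ℕ} (hf : f ∈ degLT δ m) (c : F) :
    translate δ c f ∈ degLT δ m := by
  have degree_lt : (toPoly f).degree < m := Polynomial.mem_degreeLT.1 hf
  rw [← Polynomial.degree_taylor _ (algebraMap F A c), ← toPoly_translate] at degree_lt
  exact Polynomial.mem_degreeLT.2 degree_lt

theorem natDeg_cast_eq_zero_of_translate_one_eq {f : DiffPoly δ} (hf : f.Monic)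
    (h : translate δ 1 f = f) : (f.natDeg : A) = 0 := by
  rcases Nat.eq_zero_or_pos f.natDeg with h0 | hpos
  · rw [h0, Nat.cast_zero]
  obtain ⟨m, hm⟩ := Nat.exists_eq_add_one_of_ne_zero hpos.ne'
  have natDegree_hasseDeriv_lt : (Polynomial.hasseDeriv m (toPoly f)).natDegree < 2 := by
    have := Polynomial.natDegree_hasseDeriv_le (toPoly f) m
    change _ ≤ f.natDeg - m at this
    omega
  have coeff_translate : coeff (translate δ 1 f) m = coeff f m + f.natDeg := by
    change (toPoly (translate δ 1 f)).coeff m = _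
    rw [toPoly_translate, map_one, Polynomial.taylor_coeff,
      Polynomial.eval_eq_sum_range' natDegree_hasseDeriv_lt, Finset.sum_range_succ,
      Finset.sum_range_one, Polynomial.hasseDeriv_coeff, Polynomial.hasseDeriv_coeff,
      coeff_toPoly, coeff_toPoly, add_comm 1 m, ← hm, hf.coeff_natDeg, zero_add, hm]
    simp
  rwa [h, left_eq_add] at coeff_translate

theorem translate_t_pow_sub (p : ℕ) [Fact p.Prime] [CharP F p] {c : F} (hc : c ^ p = c) (d : A) :
    translate δ c (t δ ^ p - t δ - C δ d) = t δ ^ p - t δ - C δ d := by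
  have commute : Commute (t δ) (algebraMap F (DiffPoly δ) c) := (Algebra.commutes c (t δ)).symm
  obtain ⟨r, hr⟩ := commute.exists_add_pow_prime_eq (Fact.out : p.Prime)
  have natCast_eq_zero : (p : DiffPoly δ) = 0 := by
    rw [← map_natCast (algebraMap F (DiffPoly δ)), CharP.cast_eq_zero, map_zero]
  rw [map_sub, map_sub, map_pow, translate_t, translate_C, hr, natCast_eq_zero, ← map_pow, hc]
  noncomm_ring

end Translation

end DiffPoly

section Codimension

variable {K R M : Type*} [Ring R] [AddCommGroup M] [Module R M]

/-- The Chinese remainder isomorphism for two comaximal submodules. -/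
def quotientInfEquivProd {P Q : Submodule R M} (h : P ⊔ Q = ⊤) :
    (M ⧸ P ⊓ Q) ≃ₗ[R] (M ⧸ P) × (M ⧸ Q) :=
  Submodule.quotEquivOfEq _ _ (by rw [LinearMap.ker_prod, P.ker_mkQ, Q.ker_mkQ]) ≪≫ₗ
    (P.mkQ.prod Q.mkQ).quotKerEquivOfSurjective (by
      rw [← LinearMap.range_eq_top, LinearMap.range_prod_eq (by rwa [P.ker_mkQ, Q.ker_mkQ]),
        P.range_mkQ, Q.range_mkQ, Submodule.prod_top])

variable [DivisionRing K] [Module K M] [SMul K R] [IsScalarTower K R M]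

/-- Each coatom either contains the intersection of the previous ones or is comaximal with it, and
then adds exactly `k` to the codimension. -/
theorem dvd_finrank_quotient_inf {ι : Type*} (s : Finset ι) {P : ι → Submodule R M} {k : ℕ}
    (hP : ∀ i, IsCoatom (P i)) [∀ i, Module.Finite K (M ⧸ P i)]
    (hk : ∀ i, Module.finrank K (M ⧸ P i) = k) :
    Module.Finite K (M ⧸ s.inf P) ∧ k ∣ Module.finrank K (M ⧸ s.inf P) := by
  classical
  induction s using Finset.induction_on with
  | empty =>
    have : Subsingleton (M ⧸ (∅ : Finset ι).inf P) := Submodule.Quotient.subsingleton_iff.2 rfl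
    exact ⟨inferInstance, by rw [Module.finrank_zero_of_subsingleton]; exact dvd_zero k⟩
  | insert i s _ ih =>
    obtain ⟨_, hdvd⟩ := ih
    rw [Finset.inf_insert]
    by_cases hle : s.inf P ≤ P i
    · rw [inf_eq_right.2 hle]
      exact ⟨‹_›, hdvd⟩
    · let e := (quotientInfEquivProd ((hP i).2 _ (left_lt_sup.2 hle))).restrictScalars K
      refine ⟨Module.Finite.equiv e.symm, ?_⟩
      rw [e.finrank_eq, Module.finrank_prod, hk i]
      exact dvd_add dvd_rfl hdvd

end Codimension

namespace DiffPoly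

section RightDivision

variable {F A : Type*} [CommRing F] [Ring A] [Algebra F A] {δ : NCDerivation F A}

theorem modR_eq_zero_iff {f : DiffPoly δ} (hf : f.Monic) {g : DiffPoly δ} :
    modR f hf g = 0 ↔ g ∈ Ideal.span {f} := by
  rw [Ideal.mem_span_singleton']
  constructor
  · intro h
    obtain ⟨q, hq⟩ := modR_eq f hf g
    exact ⟨q, by rw [hq, h, add_zero]⟩
  · rintro ⟨q, rfl⟩
    exact modR_unique f hf _ 0 q (Submodule.zero_mem _) (add_zero _).symm

theorem sub_modR_mem_span {f : DiffPoly δ} (hf : f.Monic) (g : DiffPoly δ) :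
    g - modR f hf g ∈ Ideal.span {f} := by
  obtain ⟨q, hq⟩ := modR_eq f hf g
  exact Ideal.mem_span_singleton'.2 ⟨q, eq_sub_of_add_eq hq.symm⟩

theorem eq_zero_of_mem_span {f : DiffPoly δ} (hf : f.Monic) {g : DiffPoly δ}
    (hg : g ∈ Ideal.span {f}) (hdeg : g ∈ degLT δ f.natDeg) : g = 0 := by
  rw [← modR_of_mem f hf g hdeg]
  exact (modR_eq_zero_iff hf).2 hg

theorem natDeg_lt_of_mem_degLT {f : DiffPoly δ} {m : ℕ} (hf : f ∈ degLT δ m) (h0 : f ≠ 0) :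
    f.natDeg < m := by
  by_contra! hle
  exact h0 (Polynomial.leadingCoeff_eq_zero.1 (mem_degLT.1 hf f.natDeg hle))

theorem natDeg_le_of_mem_span {f h : DiffPoly δ} (hf : f ≠ 0) (hh : h.Monic)
    (hmem : f ∈ Ideal.span {h}) : h.natDeg ≤ f.natDeg := by
  by_contra! hlt
  exact hf (eq_zero_of_mem_span hh hmem (mem_degLT_of_natDeg_lt hlt))

theorem eq_of_mem_span {f h : DiffPoly δ} (hf : f.Monic) (hh : h.Monic)
    (hdeg : f.natDeg = h.natDeg) (hmem : f ∈ Ideal.span {h}) : f = h := by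
  refine sub_eq_zero.1 <| eq_zero_of_mem_span hh
    (Ideal.sub_mem _ hmem (Ideal.mem_span_singleton_self h)) (mem_degLT.2 fun k hk => ?_)
  rw [coeff_sub]
  rcases hk.eq_or_lt with rfl | hk
  · rw [hh.coeff_natDeg, ← hdeg, hf.coeff_natDeg, sub_self]
  · rw [mem_degLT.1 (mem_degLT_natDeg_add_one h) k hk,
      mem_degLT.1 (mem_degLT_natDeg_add_one f) k (hdeg ▸ hk), sub_zero]

theorem Monic.ne_zero [Nontrivial A] {f : DiffPoly δ} (hf : f.Monic) : f ≠ 0 :=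
  Polynomial.Monic.ne_zero hf

theorem span_eq_top_iff [Nontrivial A] {f : DiffPoly δ} (hf : f.Monic) :
    Ideal.span {f} = ⊤ ↔ f.natDeg = 0 := by
  constructor
  · intro h
    exact Nat.le_zero.1 ((natDeg_le_of_mem_span one_ne_zero hf ((Ideal.eq_top_iff_one _).1 h)).trans
      Polynomial.natDegree_one.le)
  · intro h
    have eq_one : f = 1 := Polynomial.eq_one_of_monic_natDegree_zero (p := toPoly f) hf h
    rw [eq_one, Ideal.span_singleton_one]

theorem monic_t_sub_C (z : A) : (t δ - C δ z).Monic := Polynomial.monic_X_sub_C z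

theorem natDeg_t_sub_C [Nontrivial A] (z : A) : (t δ - C δ z).natDeg = 1 :=
  Polynomial.natDegree_X_sub_C z

theorem eq_t_sub_C_of_natDeg_eq_one {h : DiffPoly δ} (hh : h.Monic) (hdeg : h.natDeg = 1) :
    ∃ z, h = t δ - C δ z := by
  have eq_add := eq_sum (mem_degLT_natDeg_add_one h)
  have leading := hh.coeff_natDeg
  rw [hdeg] at eq_add leading
  rw [Finset.sum_range_succ, Finset.sum_range_one, leading, C_one, pow_zero, mul_one, one_mul,
    pow_one] at eq_add
  exact ⟨-coeff h 0, by rw [C_neg, sub_neg_eq_add, add_comm, ← eq_add]⟩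

theorem natDeg_t_pow_sub [Nontrivial A] {p : ℕ} (hp : 1 < p) (d : A) :
    (t δ ^ p - t δ - C δ d).natDeg = p := by
  have natDegree_X_pow : (Polynomial.X ^ p : A[X]).natDegree = p := Polynomial.natDegree_X_pow p
  rw [sub_sub, t_pow]
  refine (Polynomial.natDegree_sub_eq_left_of_natDegree_lt ?_).trans natDegree_X_pow
  rw [natDegree_X_pow]
  exact (Polynomial.natDegree_X_add_C d).trans_lt hp

theorem t_pow_sub_mem_span_iff [Nontrivial A] (p : ℕ) [hp : Fact p.Prime] [CharP F p] (d z : A) :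
    t δ ^ p - t δ - C δ d ∈ Ideal.span {t δ - C δ z} ↔ d = V δ p z - z := by
  have division : t δ ^ p - t δ - C δ d =
      ((t δ - C δ z) ^ (p - 1) - 1) * (t δ - C δ z) + C δ (V δ p z - z - d) := by
    rw [sub_mul, one_mul, ← pow_succ, Nat.sub_add_cancel hp.out.one_le, sub_C_pow, C_sub, C_sub]
    abel
  have remainder_mem : C δ (V δ p z - z - d) ∈ degLT δ (t δ - C δ z).natDeg := by
    refine mem_degLT.2 fun k hk => ?_
    rw [natDeg_t_sub_C] at hk
    rw [coeff_C, if_neg (by omega)]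
  rw [← modR_eq_zero_iff (monic_t_sub_C z), modR_unique _ _ _ _ _ remainder_mem division, ← C_zero,
    C_injective.eq_iff, sub_eq_zero, eq_comm]

theorem eq_V_sub_iff (p : ℕ) [Fact p.Prime] [CharP F p] (d z : A) :
    d = V δ p z - z ↔ C δ d = t δ ^ p - (t δ - C δ z) ^ p - C δ z := by
  rw [sub_C_pow, sub_sub_cancel, ← C_sub, C_injective.eq_iff]

end RightDivision

section Quotient

variable {F A : Type*} [CommRing F] [Ring A] [Algebra F A] {δ : NCDerivation F A}

/-- The remainders of right division by `f`, as representatives of the left `A`-module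
`A[t;δ]/A[t;δ]f`. -/
def degreeLTEquivQuotient {f : DiffPoly δ} (hf : f.Monic) :
    Polynomial.degreeLT A f.natDeg ≃ₗ[A] DiffPoly δ ⧸ Ideal.span {f} :=
  LinearEquiv.ofBijective
    ((Submodule.mkQ (Ideal.span {f})).restrictScalars A ∘ₗ toPoly.symm.toLinearMap ∘ₗ
      (Polynomial.degreeLT A f.natDeg).subtype) <| by
    refine ⟨(injective_iff_map_eq_zero _).2 fun g hg => Subtype.ext ?_, fun x => ?_⟩
    · exact eq_zero_of_mem_span hf ((Submodule.Quotient.mk_eq_zero _).1 hg) g.2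
    · obtain ⟨g, rfl⟩ := Submodule.mkQ_surjective _ x
      refine ⟨⟨modR f hf g, modR_mem f hf g⟩, Eq.symm ?_⟩
      exact (Submodule.Quotient.eq _).2 (sub_modR_mem_span hf g)

theorem finite_quotient_span {f : DiffPoly δ} (hf : f.Monic) :
    Module.Finite A (DiffPoly δ ⧸ Ideal.span {f}) :=
  Module.Finite.equiv ((Polynomial.degreeLTEquiv A f.natDeg).symm ≪≫ₗ degreeLTEquivQuotient hf)

theorem finrank_quotient_span [StrongRankCondition A] {f : DiffPoly δ} (hf : f.Monic) :
    Module.finrank A (DiffPoly δ ⧸ Ideal.span {f}) = f.natDeg := by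
  rw [← (degreeLTEquivQuotient hf).finrank_eq, (Polynomial.degreeLTEquiv A f.natDeg).finrank_eq,
    Module.finrank_fin_fun]

end Quotient

section DivisionRing

variable {F A : Type*} [CommRing F] [DivisionRing A] [Algebra F A] {δ : NCDerivation F A}

theorem exists_monic_smul {g : DiffPoly δ} (hg : g ≠ 0) :
    ∃ a : A, (a • g).Monic ∧ (a • g).natDeg = g.natDeg := by
  let lc := (toPoly g).leadingCoeff
  have lc_ne_zero : lc ≠ 0 := Polynomial.leadingCoeff_ne_zero.2 hg
  have smul_eq : toPoly (lc⁻¹ • g) = Polynomial.C lc⁻¹ * toPoly g := Polynomial.smul_eq_C_mul _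
  refine ⟨lc⁻¹, ?_, ?_⟩
  · change (toPoly (lc⁻¹ • g)).Monic
    rw [smul_eq]
    exact Polynomial.monic_C_mul_of_mul_leadingCoeff_eq_one (inv_mul_cancel₀ lc_ne_zero)
  · exact (congrArg Polynomial.natDegree smul_eq).trans
      (Polynomial.natDegree_C_mul (inv_ne_zero lc_ne_zero))

theorem exists_monic_span {J : Ideal (DiffPoly δ)} (hJ : J ≠ ⊥) :
    ∃ h : DiffPoly δ, h.Monic ∧ J = Ideal.span {h} := by
  obtain ⟨g, ⟨hgJ, hg0⟩, hmin⟩ := exists_minimalFor_of_wellFoundedLT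
    (fun g : DiffPoly δ => g ∈ J ∧ g ≠ 0) natDeg (Submodule.exists_mem_ne_zero_of_ne_bot hJ)
  obtain ⟨a, hmonic, hdeg⟩ := exists_monic_smul hg0
  have hmem : a • g ∈ J := by
    rw [← C_mul]
    exact J.mul_mem_left _ hgJ
  refine ⟨a • g, hmonic, le_antisymm (fun x hx => ?_) ((Ideal.span_singleton_le_iff_mem J).2 hmem)⟩
  rw [← modR_eq_zero_iff hmonic]
  by_contra hne
  have modR_mem_J : modR _ hmonic x ∈ J := by
    have := J.sub_mem hx ((Ideal.span_singleton_le_iff_mem J).2 hmem (sub_modR_mem_span hmonic x))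
    rwa [sub_sub_cancel] at this
  have modR_natDeg_lt := natDeg_lt_of_mem_degLT (modR_mem _ hmonic x) hne
  rw [hdeg] at modR_natDeg_lt
  exact modR_natDeg_lt.not_ge (hmin ⟨modR_mem_J, hne⟩ modR_natDeg_lt.le)

end DivisionRing

section Translates

variable {F A : Type*} [CommRing F] [Ring A] [Algebra F A] {δ : NCDerivation F A}

theorem translate_natCast_eq {f : DiffPoly δ} (h : translate δ 1 f = f) (n : ℕ) :
    translate δ (n : F) f = f := by
  induction n with
  | zero => rw [Nat.cast_zero, translate_zero, AlgHom.id_apply]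
  | succ n ih => rw [Nat.cast_succ, ← translate_comp_translate, AlgHom.comp_apply, h, ih]

theorem map_translateEquiv_span (c : F) (f : DiffPoly δ) :
    (Ideal.span {f}).map (translateEquiv δ c) = Ideal.span {translate δ c f} := by
  rw [Ideal.map_span, Set.image_singleton]
  rfl

theorem translate_mem_span {f g : DiffPoly δ} (c : F) (h : g ∈ Ideal.span {f}) :
    translate δ c g ∈ Ideal.span {translate δ c f} := by
  rw [← map_translateEquiv_span]
  exact Ideal.mem_map_of_mem (translateEquiv δ c) h

theorem dvd_natDeg_of_translate_one_mem_span (p : ℕ) [CharP A p] {u : DiffPoly δ} (hu : u.Monic)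
    (h : translate δ 1 u ∈ Ideal.span {u}) : p ∣ u.natDeg := by
  rw [← CharP.cast_eq_zero_iff A p]
  exact natDeg_cast_eq_zero_of_translate_one_eq hu
    (eq_of_mem_span (hu.translate 1) hu (natDeg_translate 1 u) h)

/-- The intersection of the translates of the left ideal generated by `h` by the prime field. -/
def translatesInf (p : ℕ) [Fact p.Prime] [CharP F p] (h : DiffPoly δ) : Ideal (DiffPoly δ) :=
  Finset.univ.inf fun i : ZMod p => Ideal.span {translate δ (ZMod.castHom dvd_rfl F i) h}

variable {p : ℕ} [Fact p.Prime] [CharP F p]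

theorem mem_translatesInf {g h : DiffPoly δ} : g ∈ translatesInf p h ↔
    ∀ i : ZMod p, g ∈ Ideal.span {translate δ (ZMod.castHom dvd_rfl F i) h} := by
  simp only [translatesInf, Submodule.mem_finsetInf, Finset.mem_univ, true_imp_iff]

theorem translatesInf_le_span (h : DiffPoly δ) : translatesInf p h ≤ Ideal.span {h} := by
  intro g hg
  have mem_zero := mem_translatesInf.1 hg 0
  rwa [map_zero, translate_zero, AlgHom.id_apply] at mem_zero

theorem translate_one_mem_translatesInf {g h : DiffPoly δ} (hg : g ∈ translatesInf p h) :
    translate δ 1 g ∈ translatesInf p h := by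
  refine mem_translatesInf.2 fun i => ?_
  have := translate_mem_span 1 (mem_translatesInf.1 hg (i - 1))
  rwa [← AlgHom.comp_apply, translate_comp_translate, map_sub, map_one, add_sub_cancel] at this

theorem mem_translatesInf_of_translate_one_eq {f h : DiffPoly δ} (hf : translate δ 1 f = f)
    (hmem : f ∈ Ideal.span {h}) : f ∈ translatesInf p h := by
  refine mem_translatesInf.2 fun i => ?_
  have := translate_mem_span (i.val : F) hmem
  rwa [translate_natCast_eq hf, ZMod.natCast_val] at this

end Translates

section Maximality

variable {F A : Type*} [Field F] [DivisionRing A] [Algebra F A] {δ : NCDerivation F A} {p : ℕ}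
  [hp : Fact p.Prime] [CharP F p]

theorem natDeg_dvd_finrank_quotient_translatesInf {h : DiffPoly δ} (hh : h.Monic)
    (hmax : (Ideal.span {h}).IsMaximal) :
    h.natDeg ∣ Module.finrank A (DiffPoly δ ⧸ translatesInf p h) := by
  let P (i : ZMod p) : Ideal (DiffPoly δ) :=
    Ideal.span {translate δ (ZMod.castHom dvd_rfl F i) h}
  have isCoatom (i : ZMod p) : IsCoatom (P i) := by
    have : ((Ideal.span {h}).map (translateEquiv δ (ZMod.castHom dvd_rfl F i))).IsMaximal :=
      Ideal.map_isMaximal_of_equiv _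
    rw [map_translateEquiv_span] at this
    exact this.out
  have (i : ZMod p) : Module.Finite A (DiffPoly δ ⧸ P i) := finite_quotient_span (hh.translate _)
  exact (dvd_finrank_quotient_inf Finset.univ isCoatom fun i =>
    (finrank_quotient_span (hh.translate _)).trans (natDeg_translate _ h)).2

/-- The generator `u` of the intersection of the `𝔽ₚ`-translates of `A[t;δ]h` is invariant under
translation, which forces `deg u = p`. -/
theorem natDeg_eq_one_or_eq_of_mem_span {f h : DiffPoly δ} (hf : f.Monic) (hdeg : f.natDeg = p)
    (hinv : translate δ 1 f = f) (hh : h.Monic) (hmax : (Ideal.span {h}).IsMaximal)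
    (hmem : f ∈ Ideal.span {h}) : h.natDeg = 1 ∨ f = h := by
  have hfN : f ∈ translatesInf p h := mem_translatesInf_of_translate_one_eq hinv hmem
  have N_ne_bot : translatesInf p h ≠ ⊥ := (Submodule.ne_bot_iff _).2 ⟨f, hfN, hf.ne_zero⟩
  obtain ⟨u, hu, hNu⟩ := exists_monic_span N_ne_bot
  have huN : u ∈ translatesInf p h := hNu ▸ Ideal.mem_span_singleton_self u
  have : CharP A p := charP_of_injective_algebraMap (algebraMap F A).injective p
  have p_dvd : p ∣ u.natDeg :=
    dvd_natDeg_of_translate_one_mem_span p hu (hNu ▸ translate_one_mem_translatesInf huN)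
  have natDeg_ne_zero : u.natDeg ≠ 0 := fun h0 =>
    hmax.ne_top (top_le_iff.1 (((span_eq_top_iff hu).2 h0).ge.trans
      (hNu.ge.trans (translatesInf_le_span h))))
  have natDeg_u : u.natDeg = p :=
    le_antisymm (hdeg ▸ natDeg_le_of_mem_span hf.ne_zero hu (hNu ▸ hfN))
      (Nat.le_of_dvd (Nat.pos_of_ne_zero natDeg_ne_zero) p_dvd)
  have natDeg_dvd : h.natDeg ∣ p := by
    rw [← natDeg_u, ← finrank_quotient_span hu, ← hNu]
    exact natDeg_dvd_finrank_quotient_translatesInf hh hmax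
  exact ((Nat.dvd_prime hp.out).1 natDeg_dvd).imp_right fun hp' =>
    eq_of_mem_span hf hh (hdeg.trans hp'.symm) hmem

theorem isMaximal_span_iff_forall_notMem {f : DiffPoly δ} (hf : f.Monic) (hdeg : f.natDeg = p)
    (hinv : translate δ 1 f = f) :
    (Ideal.span {f}).IsMaximal ↔ ∀ z, f ∉ Ideal.span {t δ - C δ z} := by
  constructor
  · intro hmax z hz
    have span_ne_top : Ideal.span {t δ - C δ z} ≠ ⊤ := by
      rw [Ne, span_eq_top_iff (monic_t_sub_C z), natDeg_t_sub_C]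
      exact one_ne_zero
    have span_eq := hmax.eq_of_le span_ne_top ((Ideal.span_singleton_le_iff_mem _).2 hz)
    have natDeg_eq := finrank_quotient_span hf
    rw [span_eq, finrank_quotient_span (monic_t_sub_C z), natDeg_t_sub_C, hdeg] at natDeg_eq
    exact hp.out.one_lt.ne natDeg_eq
  · intro hz
    have span_ne_top : Ideal.span {f} ≠ ⊤ := by
      rw [Ne, span_eq_top_iff hf, hdeg]
      exact hp.out.ne_zero
    obtain ⟨J, hJmax, hfJ⟩ := Ideal.exists_le_maximal _ span_ne_top
    obtain ⟨h, hh, rfl⟩ := exists_monic_span (ne_bot_of_le_ne_bot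
      (mt Ideal.span_singleton_eq_bot.1 hf.ne_zero) hfJ)
    have hmem := (Ideal.span_singleton_le_iff_mem _).1 hfJ
    rcases natDeg_eq_one_or_eq_of_mem_span hf hdeg hinv hh hJmax hmem with h1 | rfl
    · obtain ⟨z, rfl⟩ := eq_t_sub_C_of_natDeg_eq_one hh h1
      exact absurd hmem (hz z)
    · exact hJmax

end Maximality

end DiffPoly

theorem isDivisionAlgebra_of_noZeroDivisors (F : Type*) {B : Type*} [Field F]
    [NonUnitalNonAssocRing B] [Module F B] [IsScalarTower F B B] [SMulCommClass F B B]
    [FiniteDimensional F B] [Nontrivial B] [NoZeroDivisors B] : IsDivisionAlgebra B := by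
  refine ⟨inferInstance, fun a ha => ⟨?_, ?_⟩⟩
  · have hinj : Function.Injective (LinearMap.mulLeft F a) :=
      (injective_iff_map_eq_zero _).2 fun x hx => (mul_eq_zero.1 hx).resolve_left ha
    exact ⟨hinj, LinearMap.injective_iff_surjective.1 hinj⟩
  · have hinj : Function.Injective (LinearMap.mulRight F a) :=
      (injective_iff_map_eq_zero _).2 fun x hx => (mul_eq_zero.1 hx).resolve_right ha
    exact ⟨hinj, LinearMap.injective_iff_surjective.1 hinj⟩

namespace IsDivisionAlgebra

theorem isUnit {A : Type*} [Ring A] (hA : IsDivisionAlgebra A) {a : A} (ha : a ≠ 0) :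
    IsUnit a := by
  obtain ⟨b, hb⟩ := (hA.2 a ha).1.2 1
  obtain ⟨c, hc⟩ := (hA.2 a ha).2.2 1
  exact isUnit_iff_exists.2 ⟨b, hb, by rwa [left_inv_eq_right_inv hc hb] at hc⟩

/-- The division ring structure on an associative division algebra. -/
abbrev divisionRing {A : Type*} [Ring A] (hA : IsDivisionAlgebra A) : DivisionRing A :=
  have := hA.1
  DivisionRing.ofIsUnitOrEqZero fun _ => or_iff_not_imp_right.2 hA.isUnit

theorem of_mulEquiv {A B : Type*} [NonUnitalNonAssocRing A] [NonUnitalNonAssocRing B]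
    (φ : A ≃* B) (hA : IsDivisionAlgebra A) : IsDivisionAlgebra B := by
  have := hA.1
  refine ⟨φ.injective.nontrivial, fun b hb => ?_⟩
  obtain ⟨left, right⟩ := hA.2 (φ.symm b) ((map_ne_zero_iff φ.symm φ.symm.injective).2 hb)
  constructor
  · convert φ.bijective.comp (left.comp φ.symm.bijective) using 1
    ext x
    simp
  · convert φ.bijective.comp (right.comp φ.symm.bijective) using 1
    ext x
    simp

theorem congr {A B : Type*} [NonUnitalNonAssocRing A] [NonUnitalNonAssocRing B] (φ : A ≃* B) :
    IsDivisionAlgebra A ↔ IsDivisionAlgebra B :=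
  ⟨of_mulEquiv φ, of_mulEquiv φ.symm⟩

end IsDivisionAlgebra

namespace PetitAlgebra

open DiffPoly

section Coordinates

variable {F A : Type*} [CommRing F] [Ring A] [Algebra F A] {δ : NCDerivation F A}
  {f : DiffPoly δ} {hf : f.Monic}

theorem mk_eq_zero_iff {g : DiffPoly δ} : mk f hf g = 0 ↔ g ∈ Ideal.span {f} := by
  rw [← modR_eq_zero_iff hf]
  exact Subtype.ext_iff

variable (f hf) in
/-- The quotient map `A[t;δ] → S_f` as a linear map. -/
def mkHom : DiffPoly δ →ₗ[F] PetitAlgebra f hf where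
  toFun := mk f hf
  map_add' g h := ext_rep f hf (modR_add f hf g h)
  map_smul' c g := ext_rep f hf (modR_smul f hf c g)

theorem mk_eq_mk_iff {g h : DiffPoly δ} : mk f hf g = mk f hf h ↔ g - h ∈ Ideal.span {f} := by
  rw [← mk_eq_zero_iff (hf := hf), ← sub_eq_zero]
  exact (congrArg (· = 0) (map_sub (mkHom f hf) g h).symm).to_iff

theorem mul_mk (x : PetitAlgebra f hf) (g : DiffPoly δ) : x * mk f hf g = mk f hf (x.rep * g) := by
  refine (mk_eq_mk_iff.2 ?_).symm
  rw [← mul_sub]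
  exact Ideal.mul_mem_left _ _ (sub_modR_mem_span hf g)

theorem mk_rep (x : PetitAlgebra f hf) : mk f hf x.rep = x := ext_rep f hf (modR_rep f hf x)

theorem rep_mk_of_mem {g : DiffPoly δ} (hg : g ∈ degLT δ f.natDeg) : (mk f hf g).rep = g :=
  modR_of_mem f hf g hg

variable (f hf) in
/-- The coordinates of an element of `S_f` in the left `A`-basis `1, t, …, t ^ (m - 1)`. -/
def coordinates : PetitAlgebra f hf ≃ₗ[F] (Fin f.natDeg → A) :=
  (Polynomial.degreeLTEquiv A f.natDeg).restrictScalars F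

theorem coordinates_apply (x : PetitAlgebra f hf) (i : Fin f.natDeg) :
    coordinates f hf x i = coeff x.rep i := rfl

instance [Module.Finite F A] : Module.Finite F (PetitAlgebra f hf) :=
  Module.Finite.equiv (coordinates f hf).symm

theorem finrank_eq [StrongRankCondition F] [Module.Free F A] [Module.Finite F A] :
    Module.finrank F (PetitAlgebra f hf) = f.natDeg * Module.finrank F A := by
  rw [(coordinates f hf).finrank_eq, Module.finrank_pi_fintype, Finset.sum_const,
    Finset.card_univ, Fintype.card_fin, smul_eq_mul]

theorem isMaximal_span_of_isDivisionAlgebra (h : IsDivisionAlgebra (PetitAlgebra f hf)) :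
    (Ideal.span {f}).IsMaximal := by
  have := h.1
  refine Ideal.isMaximal_iff.2 ⟨fun one_mem => ?_, fun J g hJ g_notMem g_mem => ?_⟩
  · exact one_ne_zero (mk_eq_zero_iff.2 one_mem : (1 : PetitAlgebra f hf) = 0)
  · have g_ne_zero : mk f hf g ≠ 0 := mt mk_eq_zero_iff.1 g_notMem
    obtain ⟨v, hv⟩ := (h.2 _ g_ne_zero).2.2 1
    have sub_mem : v.rep * g - 1 ∈ J := hJ (mk_eq_mk_iff.1 ((mul_mk v g).symm.trans hv))
    exact (Submodule.sub_mem_iff_right J (J.mul_mem_left v.rep g_mem)).1 sub_mem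

end Coordinates

section DivisionRing

variable {F A : Type*} [Field F] [DivisionRing A] [Algebra F A] {δ : NCDerivation F A}
  {f : DiffPoly δ} {hf : f.Monic}

/-- The annihilator of the class of `y` in the simple module `A[t;δ]/A[t;δ]f` is generated by a
polynomial of degree `deg f`, so it contains no nonzero polynomial of smaller degree. -/
theorem noZeroDivisors_of_isMaximal (hmax : (Ideal.span {f}).IsMaximal) :
    NoZeroDivisors (PetitAlgebra f hf) := by
  refine ⟨fun {x y} hxy => or_iff_not_imp_right.2 fun hy => by_contra fun hx => ?_⟩
  have : IsSimpleModule (DiffPoly δ) (DiffPoly δ ⧸ Ideal.span {f}) :=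
    isSimpleModule_iff_isCoatom.2 hmax.out
  let m : DiffPoly δ ⧸ Ideal.span {f} := Submodule.Quotient.mk y.rep
  have m_ne_zero : m ≠ 0 := fun hm => hy (by
    rw [← mk_rep y, mk_eq_zero_iff]
    exact (Submodule.Quotient.mk_eq_zero _).1 hm)
  let T := LinearMap.toSpanSingleton (DiffPoly δ) _ m
  have T_surj : Function.Surjective T := IsSimpleModule.toSpanSingleton_surjective _ m_ne_zero
  have x_mem : x.rep ∈ LinearMap.ker T :=
    (Submodule.Quotient.mk_eq_zero _).2 (mk_eq_zero_iff.1 hxy)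
  have x_ne_zero : x.rep ≠ 0 := fun h0 => hx (ext_rep f hf h0)
  obtain ⟨u, hu, ker_eq⟩ := exists_monic_span ((Submodule.ne_bot_iff _).2 ⟨_, x_mem, x_ne_zero⟩)
  have natDeg_u : u.natDeg = f.natDeg := by
    rw [← finrank_quotient_span hu, ← finrank_quotient_span hf, ← ker_eq]
    exact ((T.quotKerEquivOfSurjective T_surj).restrictScalars A).finrank_eq
  exact x_ne_zero (eq_zero_of_mem_span hu (ker_eq ▸ x_mem) (natDeg_u ▸ x.2))

theorem isDivisionAlgebra_iff_isMaximal [FiniteDimensional F A] :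
    IsDivisionAlgebra (PetitAlgebra f hf) ↔ (Ideal.span {f}).IsMaximal := by
  refine ⟨isMaximal_span_of_isDivisionAlgebra, fun hmax => ?_⟩
  have := noZeroDivisors_of_isMaximal (hf := hf) hmax
  have : Nontrivial (PetitAlgebra f hf) :=
    nontrivial_of_ne 1 0 fun h => (Ideal.ne_top_iff_one _).1 hmax.ne_top (mk_eq_zero_iff.1 h)
  exact isDivisionAlgebra_of_noZeroDivisors F

end DivisionRing

end PetitAlgebra

open DiffPoly in
theorem DiffExt.isDivisionAlgebra_iff {F A : Type*} [Field F] [Ring A] [Algebra F A]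
    [FiniteDimensional F A] (hA : IsDivisionAlgebra A) (δ : NCDerivation F A) (p : ℕ)
    [hp : Fact p.Prime] [CharP F p] (d : A) :
    IsDivisionAlgebra (DiffExt δ p d) ↔ ∀ z, d ≠ V δ p z - z := by
  let := hA.divisionRing
  rw [PetitAlgebra.isDivisionAlgebra_iff_isMaximal, isMaximal_span_iff_forall_notMem
    (monic_pow_sub δ p hp.out.one_lt d) (natDeg_t_pow_sub hp.out.one_lt d)
    (translate_t_pow_sub p (one_pow p) d)]
  simp only [t_pow_sub_mem_span_iff, ne_eq]

section Conjugation

variable {R V W : Type*} [CommRing R]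

/-- Transport of linear automorphisms along a linear equivalence. -/
def linearAutCongr [AddCommMonoid V] [Module R V] [AddCommMonoid W] [Module R W]
    (φ : V ≃ₗ[R] W) : (W ≃ₗ[R] W) ≃* (V ≃ₗ[R] V) where
  toFun S := φ.trans (S.trans φ.symm)
  invFun S := φ.symm.trans (S.trans φ)
  left_inv S := by ext; simp
  right_inv S := by ext; simp
  map_mul' S T := by ext; simp

theorem apply_linearAutCongr [AddCommMonoid V] [Module R V] [AddCommMonoid W] [Module R W]
    (φ : V ≃ₗ[R] W) (S : W ≃ₗ[R] W) (x : V) : φ (linearAutCongr φ S x) = S (φ x) :=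
  φ.apply_symm_apply _

theorem NAAut.linearAutCongr_mem [NonUnitalNonAssocRing V] [Module R V]
    [NonUnitalNonAssocRing W] [Module R W] {φ : V ≃ₗ[R] W} (hφ : ∀ x y, φ (x * y) = φ x * φ y)
    {S : W ≃ₗ[R] W} (hS : S ∈ NAAut R W) : linearAutCongr φ S ∈ NAAut R V := fun x y =>
  φ.injective (by
    rw [hφ, apply_linearAutCongr, apply_linearAutCongr, apply_linearAutCongr, hφ]
    exact hS _ _)

end Conjugation

namespace PetitAlgebra

open DiffPoly

section Translation

variable {F A : Type*} [CommRing F] [Ring A] [Algebra F A] {δ : NCDerivation F A}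
  {f : DiffPoly δ} {hf : f.Monic}

variable (f hf) in
/-- The translation of representatives by a constant `c`, that is, the map `G_{id,c}` on `S_f`. -/
def translate (c : F) : PetitAlgebra f hf →ₗ[F] PetitAlgebra f hf :=
  (DiffPoly.translate δ c).toLinearMap.restrict fun _ hg => translate_mem_degLT hg c

theorem rep_translate (c : F) (x : PetitAlgebra f hf) :
    (translate f hf c x).rep = DiffPoly.translate δ c x.rep := rfl

theorem translate_translate (c c' : F) (x : PetitAlgebra f hf) :
    translate f hf c (translate f hf c' x) = translate f hf (c + c') x :=
  ext_rep f hf (DFunLike.congr_fun (translate_comp_translate c c') x.rep)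

theorem translate_zero (x : PetitAlgebra f hf) : translate f hf 0 x = x :=
  ext_rep f hf (DFunLike.congr_fun DiffPoly.translate_zero x.rep)

variable (f hf) in
/-- The translation of `S_f` by `c` as a linear automorphism. -/
def translateEquiv (c : F) : PetitAlgebra f hf ≃ₗ[F] PetitAlgebra f hf :=
  LinearEquiv.ofLinearMap (translate f hf c) (translate f hf (-c))
    (LinearMap.ext fun x => by
      rw [LinearMap.comp_apply, translate_translate, add_neg_cancel, translate_zero,
        LinearMap.id_apply])
    (LinearMap.ext fun x => by
      rw [LinearMap.comp_apply, translate_translate, neg_add_cancel, translate_zero,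
        LinearMap.id_apply])

theorem translateEquiv_apply (c : F) (x : PetitAlgebra f hf) :
    translateEquiv f hf c x = translate f hf c x := rfl

variable (f hf) in
/-- The translations of `S_f` as an action of the additive group of `F`. -/
def translateHom : Multiplicative F →* (PetitAlgebra f hf ≃ₗ[F] PetitAlgebra f hf) where
  toFun c := translateEquiv f hf c.toAdd
  map_one' := LinearEquiv.ext translate_zero
  map_mul' c c' := LinearEquiv.ext fun x => by
    rw [LinearEquiv.mul_apply, translateEquiv_apply, translateEquiv_apply, translateEquiv_apply,
      translate_translate, toAdd_mul]

theorem translateHom_apply (c : Multiplicative F) :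
    translateHom f hf c = translateEquiv f hf c.toAdd := rfl

theorem translateHom_injective [FaithfulSMul F A] (hdeg : 1 < f.natDeg) :
    Function.Injective (translateHom f hf) := by
  intro c c' h
  have t_mem : t δ ∈ degLT δ f.natDeg :=
    mem_degLT_of_natDeg_lt (Polynomial.natDegree_X_le.trans_lt hdeg)
  have translate_t_eq := congrArg rep (DFunLike.congr_fun h (mk f hf (t δ)))
  rw [translateHom_apply, translateHom_apply, translateEquiv_apply, translateEquiv_apply,
    rep_translate, rep_translate, rep_mk_of_mem t_mem, translate_t, translate_t, add_right_inj,
    algebraMap_eq_C, algebraMap_eq_C] at translate_t_eq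
  exact FaithfulSMul.algebraMap_injective F A (C_injective translate_t_eq)

theorem orderOf_translateEquiv [FaithfulSMul F A] (hdeg : 1 < f.natDeg) (c : F) :
    orderOf (translateEquiv f hf c) = addOrderOf c := by
  rw [← orderOf_ofAdd_eq_addOrderOf, ← orderOf_injective _ (translateHom_injective (hf := hf) hdeg),
    translateHom_apply, toAdd_ofAdd]

theorem translate_mk {c : F} (h : DiffPoly.translate δ c f = f) (g : DiffPoly δ) :
    translate f hf c (mk f hf g) = mk f hf (DiffPoly.translate δ c g) := by
  rw [← mk_rep (translate f hf c (mk f hf g)), mk_eq_mk_iff, rep_translate, ← neg_mem_iff, neg_sub,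
    ← map_sub]
  have := translate_mem_span c (sub_modR_mem_span hf g)
  rwa [h] at this

theorem translateEquiv_mem_NAAut {c : F} (h : DiffPoly.translate δ c f = f) :
    translateEquiv f hf c ∈ NAAut F (PetitAlgebra f hf) := fun x y => by
  rw [translateEquiv_apply, translateEquiv_apply, translateEquiv_apply, ← mk_rep y, mul_mk,
    translate_mk h, translate_mk h, mul_mk, rep_translate, map_mul]

end Translation

end PetitAlgebra

section TensorProduct

variable {F E D : Type*} [CommRing F] [CommRing E] [Algebra F E] [Ring D] [Algebra F D]
  {δ : Derivation F E E}

namespace DiffPoly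

variable (D δ) in
/-- The inclusion `E[t;δ] → D_E[t;δ]`. -/
def inclHom : DiffPoly δ.toNC →ₐ[F] DiffPoly (δ.extendNC D) :=
  lift δ.toNC ((CHom (δ.extendNC D)).comp Algebra.TensorProduct.includeRight) (t (δ.extendNC D))
    fun a => t_mul_C (δ.extendNC D) ((1 : D) ⊗ₜ[F] a)

theorem inclHom_C (a : E) : inclHom D δ (C δ.toNC a) = C (δ.extendNC D) ((1 : D) ⊗ₜ[F] a) :=
  lift_C _ _ _ a

theorem inclHom_t : inclHom D δ (t δ.toNC) = t (δ.extendNC D) := lift_t _ _ _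

theorem toPoly_inclHom (f : DiffPoly δ.toNC) :
    toPoly (inclHom D δ f) =
      (toPoly f).map (Algebra.TensorProduct.includeRight : E →ₐ[F] D ⊗[F] E).toRingHom := by
  induction f using induction_on with
  | hadd f g hf hg => rw [map_add, map_add, hf, hg, map_add, Polynomial.map_add]
  | hmon a i =>
    rw [map_mul, map_pow, inclHom_C, inclHom_t, toPoly_C_mul_t_pow, toPoly_C_mul_t_pow,
      Polynomial.map_monomial]
    rfl

theorem coeff_inclHom (f : DiffPoly δ.toNC) (n : ℕ) :
    coeff (inclHom D δ f) n = (1 : D) ⊗ₜ[F] coeff f n := by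
  rw [← coeff_toPoly, toPoly_inclHom, Polynomial.coeff_map]
  rfl

theorem natDeg_inclHom [Nontrivial (D ⊗[F] E)] {f : DiffPoly δ.toNC} (hf : f.Monic) :
    (inclHom D δ f).natDeg = f.natDeg :=
  (congrArg Polynomial.natDegree (toPoly_inclHom f)).trans (Polynomial.Monic.natDegree_map hf _)

theorem commute_inclHom (f : DiffPoly δ.toNC) (b : D) :
    Commute (inclHom D δ f) (C (δ.extendNC D) (b ⊗ₜ[F] (1 : E))) := by
  have commute_C (a : E) : Commute (C (δ.extendNC D) ((1 : D) ⊗ₜ[F] a))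
      (C (δ.extendNC D) (b ⊗ₜ[F] (1 : E))) := by
    rw [commute_iff_eq, C_mul_C, C_mul_C, Algebra.TensorProduct.tmul_mul_tmul,
      Algebra.TensorProduct.tmul_mul_tmul, one_mul, mul_one, mul_one, one_mul]
  have commute_t : Commute (t (δ.extendNC D)) (C (δ.extendNC D) (b ⊗ₜ[F] (1 : E))) := by
    have derivation_eq_zero : (δ.extendNC D).toLinearMap (b ⊗ₜ[F] (1 : E)) = 0 :=
      (congrArg _ δ.map_one_eq_zero).trans (TensorProduct.tmul_zero _ b)
    rw [commute_iff_eq, t_mul_C, derivation_eq_zero, C_zero, add_zero]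
  induction f using induction_on with
  | hadd f g hf hg => rw [map_add]; exact hf.add_left hg
  | hmon a i =>
    rw [map_mul, map_pow, inclHom_C, inclHom_t]
    exact (commute_C a).mul_left (commute_t.pow_left i)

variable (D δ) in
/-- The homomorphism `E[t;δ] ⊗ D → D_E[t;δ]`, `a tⁱ ⊗ b ↦ (b ⊗ a) tⁱ`. -/
def tensorHom : DiffPoly δ.toNC ⊗[F] D →ₐ[F] DiffPoly (δ.extendNC D) :=
  Algebra.TensorProduct.lift (inclHom D δ)
    ((CHom (δ.extendNC D)).comp Algebra.TensorProduct.includeLeft) commute_inclHom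

theorem tensorHom_tmul (f : DiffPoly δ.toNC) (b : D) :
    tensorHom D δ (f ⊗ₜ[F] b) = C (δ.extendNC D) (b ⊗ₜ[F] (1 : E)) * inclHom D δ f :=
  (Algebra.TensorProduct.lift_tmul _ _ _ f b).trans (commute_inclHom f b)

theorem coeff_tensorHom_tmul (f : DiffPoly δ.toNC) (b : D) (n : ℕ) :
    coeff (tensorHom D δ (f ⊗ₜ[F] b)) n = b ⊗ₜ[F] coeff f n := by
  rw [tensorHom_tmul, C_mul, coeff_smul, coeff_inclHom, Algebra.TensorProduct.tmul_mul_tmul,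
    mul_one, one_mul]

theorem tensorHom_monomial (a : E) (i : ℕ) (b : D) :
    tensorHom D δ ((C δ.toNC a * t δ.toNC ^ i) ⊗ₜ[F] b) =
      C (δ.extendNC D) (b ⊗ₜ[F] a) * t (δ.extendNC D) ^ i := by
  rw [tensorHom_tmul, map_mul, map_pow, inclHom_C, inclHom_t, ← mul_assoc, C_mul_C,
    Algebra.TensorProduct.tmul_mul_tmul, mul_one, one_mul]

theorem tensorHom_mem_span {f g : DiffPoly δ.toNC} (hg : g ∈ Ideal.span {f}) (b : D) :
    tensorHom D δ (g ⊗ₜ[F] b) ∈ Ideal.span {inclHom D δ f} := by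
  obtain ⟨q, rfl⟩ := Ideal.mem_span_singleton'.1 hg
  rw [tensorHom_tmul, map_mul, ← mul_assoc]
  exact Ideal.mul_mem_left _ _ (Ideal.mem_span_singleton_self _)

end DiffPoly

namespace PetitAlgebra

open DiffPoly

variable [Nontrivial (D ⊗[F] E)] {f : DiffPoly δ.toNC} {f' : DiffPoly (δ.extendNC D)}
  {hf : f.Monic} {hf' : f'.Monic}

variable (hf hf') in
/-- The isomorphism `S_f ⊗ D ≃ S_f` for a monic `f ∈ E[t;δ]`, where on the right `f` is viewed in
`D_E[t;δ]` as `f'`. -/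
def tensorEquiv (h : inclHom D δ f = f') : PetitAlgebra f hf ⊗[F] D ≃ₗ[F] PetitAlgebra f' hf' :=
  TensorProduct.comm F _ D ≪≫ₗ (coordinates f hf).lTensor D ≪≫ₗ
    TensorProduct.piRight F F D (fun _ => E) ≪≫ₗ
    LinearEquiv.funCongrLeft F _ (finCongr ((congrArg natDeg h).symm.trans (natDeg_inclHom hf)))
      ≪≫ₗ (coordinates f' hf').symm

theorem rep_tensorEquiv_tmul (h : inclHom D δ f = f') (x : PetitAlgebra f hf) (b : D) :
    (tensorEquiv hf hf' h (x ⊗ₜ b)).rep = tensorHom D δ (x.rep ⊗ₜ b) := by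
  have natDeg_eq : f'.natDeg = f.natDeg := h ▸ natDeg_inclHom hf
  have tensorHom_mem : tensorHom D δ (x.rep ⊗ₜ b) ∈ degLT (δ.extendNC D) f'.natDeg :=
    mem_degLT.2 fun k hk => by
      have coeff_eq_zero : coeff x.rep k = 0 := mem_degLT.1 x.2 k (natDeg_eq ▸ hk)
      rw [coeff_tensorHom_tmul, coeff_eq_zero, TensorProduct.tmul_zero]
  rw [← rep_mk_of_mem (hf := hf') tensorHom_mem]
  refine congrArg rep ((LinearEquiv.symm_apply_eq _).2 (funext fun i => ?_))
  rw [coordinates_apply, rep_mk_of_mem tensorHom_mem, coeff_tensorHom_tmul]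
  simp [coordinates_apply]

theorem tensorEquiv_mk_tmul (h : inclHom D δ f = f') (g : DiffPoly δ.toNC) (b : D) :
    tensorEquiv hf hf' h (mk f hf g ⊗ₜ b) = mk f' hf' (tensorHom D δ (g ⊗ₜ b)) := by
  rw [← mk_rep (tensorEquiv hf hf' h _), mk_eq_mk_iff, rep_tensorEquiv_tmul, ← neg_mem_iff,
    neg_sub, ← map_sub, ← TensorProduct.sub_tmul, ← h]
  exact tensorHom_mem_span (sub_modR_mem_span hf g) b

theorem tensorEquiv_mul (h : inclHom D δ f = f') (x y : PetitAlgebra f hf ⊗[F] D) :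
    tensorEquiv hf hf' h (x * y) = tensorEquiv hf hf' h x * tensorEquiv hf hf' h y := by
  induction x with
  | zero => rw [zero_mul, map_zero, zero_mul]
  | add x₁ x₂ h₁ h₂ => rw [add_mul, map_add, map_add, h₁, h₂, add_mul]
  | tmul x b =>
    induction y with
    | zero => rw [mul_zero, map_zero, mul_zero]
    | add y₁ y₂ h₁ h₂ => rw [mul_add, map_add, map_add, h₁, h₂, mul_add]
    | tmul y b' =>
      rw [Algebra.TensorProduct.tmul_mul_tmul, ← mk_rep y, mul_mk, tensorEquiv_mk_tmul,
        ← Algebra.TensorProduct.tmul_mul_tmul, map_mul, tensorEquiv_mk_tmul, mul_mk,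
        rep_tensorEquiv_tmul]

end PetitAlgebra

end TensorProduct

namespace DiffExt

open DiffPoly

theorem finrank_eq {F A : Type*} [Field F] [Ring A] [Nontrivial A] [Algebra F A]
    [FiniteDimensional F A] (δ : NCDerivation F A) (p : ℕ) [hp : Fact p.Prime] (d : A) :
    Module.finrank F (DiffExt δ p d) = p * Module.finrank F A := by
  rw [PetitAlgebra.finrank_eq, natDeg_t_pow_sub hp.out.one_lt]

theorem translateEquiv_neg_one_mem_NAAut {F A : Type*} [CommRing F] [Ring A] [Algebra F A]
    (δ : NCDerivation F A) (p : ℕ) [Fact p.Prime] [CharP F p] (d : A) :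
    PetitAlgebra.translateEquiv _ _ (-1) ∈ NAAut F (DiffExt δ p d) :=
  PetitAlgebra.translateEquiv_mem_NAAut (translate_t_pow_sub p (neg_one_pow_char F p) d)

theorem orderOf_translateEquiv_neg_one {F A : Type*} [CommRing F] [Ring A] [Nontrivial A]
    [Algebra F A] [FaithfulSMul F A] (δ : NCDerivation F A) (p : ℕ) [hp : Fact p.Prime]
    [CharP F p] (d : A) :
    orderOf (PetitAlgebra.translateEquiv _ _ (-1) : DiffExt δ p d ≃ₗ[F] DiffExt δ p d) = p := by
  have one_lt_natDeg := (natDeg_t_pow_sub (δ := δ) hp.out.one_lt d).symm ▸ hp.out.one_lt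
  rw [PetitAlgebra.orderOf_translateEquiv one_lt_natDeg, addOrderOf_neg]
  exact CharP.eq F (CharP.addOrderOf_one F) inferInstance

section TensorProduct

variable {F E D : Type*} [CommRing F] [CommRing E] [Algebra F E] [Ring D] [Algebra F D]
  [Nontrivial (D ⊗[F] E)]

variable (D) in
/-- The isomorphism `(E, δ, d) ⊗ D ≃ (D_E, δ, d)`, `a tⁱ ⊗ b ↦ (b ⊗ a) tⁱ`. -/
def tensorEquiv (δ : Derivation F E E) (p : ℕ) [Fact p.Prime] (d : E) :
    DiffExt δ.toNC p d ⊗[F] D ≃ₗ[F] DiffExt (δ.extendNC D) p ((1 : D) ⊗ₜ[F] d) :=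
  PetitAlgebra.tensorEquiv _ _ (by
    rw [map_sub, map_sub, map_pow, inclHom_t, inclHom_C])

variable {δ : Derivation F E E} {p : ℕ} [Fact p.Prime] {d : E}

theorem tensorEquiv_mul (x y : DiffExt δ.toNC p d ⊗[F] D) :
    tensorEquiv D δ p d (x * y) = tensorEquiv D δ p d x * tensorEquiv D δ p d y :=
  PetitAlgebra.tensorEquiv_mul _ x y

theorem tensorEquiv_monomial (a : E) (i : ℕ) (b : D) :
    tensorEquiv D δ p d (PetitAlgebra.mk _ _ (C δ.toNC a * t δ.toNC ^ i) ⊗ₜ[F] b) =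
      PetitAlgebra.mk _ _ (C (δ.extendNC D) (b ⊗ₜ[F] a) * t (δ.extendNC D) ^ i) := by
  rw [tensorEquiv, PetitAlgebra.tensorEquiv_mk_tmul, tensorHom_monomial]

theorem tensorEquiv_one_tmul (b : D) :
    tensorEquiv D δ p d (1 ⊗ₜ[F] b) = PetitAlgebra.mk _ _ (C (δ.extendNC D) (b ⊗ₜ[F] 1)) := by
  have monomial := tensorEquiv_monomial (δ := δ) (p := p) (d := d) 1 0 b
  rwa [C_one, pow_zero, pow_zero, mul_one, mul_one] at monomial

variable (D) in
/-- The automorphism `G = G_{id,-1}` of `(E, δ, d) ⊗ D`, transported from `(D_E, δ, d)`. -/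
def tensorTranslate (δ : Derivation F E E) (p : ℕ) [Fact p.Prime] (d : E) :
    DiffExt δ.toNC p d ⊗[F] D ≃ₗ[F] DiffExt δ.toNC p d ⊗[F] D :=
  linearAutCongr (tensorEquiv D δ p d) (PetitAlgebra.translateEquiv _ _ (-1))

theorem rep_tensorEquiv_tensorTranslate (x : DiffExt δ.toNC p d ⊗[F] D) :
    (tensorEquiv D δ p d (tensorTranslate D δ p d x)).rep =
      shift (-1) (tensorEquiv D δ p d x).rep := by
  rw [tensorTranslate, apply_linearAutCongr, PetitAlgebra.translateEquiv_apply,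
    PetitAlgebra.rep_translate, ← shift_algebraMap, map_neg, map_one]

variable [CharP F p]

theorem tensorTranslate_mem_NAAut :
    tensorTranslate D δ p d ∈ NAAut F (DiffExt δ.toNC p d ⊗[F] D) :=
  NAAut.linearAutCongr_mem tensorEquiv_mul (translateEquiv_neg_one_mem_NAAut _ p _)

theorem tensorTranslate_one_tmul (b : D) : tensorTranslate D δ p d (1 ⊗ₜ[F] b) = 1 ⊗ₜ[F] b := by
  apply (tensorEquiv D δ p d).injective
  rw [tensorTranslate, apply_linearAutCongr, tensorEquiv_one_tmul,
    PetitAlgebra.translateEquiv_apply, PetitAlgebra.translate_mk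
      (translate_t_pow_sub p (neg_one_pow_char F p) _), translate_C]

theorem orderOf_tensorTranslate [FaithfulSMul F (D ⊗[F] E)] :
    orderOf (tensorTranslate D δ p d) = p :=
  (MulEquiv.orderOf_eq _ _).trans (orderOf_translateEquiv_neg_one (δ.extendNC D) p _)

end TensorProduct

end DiffExt

section Eigenspaces

open Polynomial

variable {F V : Type*} [Field F] [AddCommGroup V] [Module F V] [FiniteDimensional F V]

theorem finrank_ker_aeval_prod_X_sub_C_le (f : Module.End F V) (s : Finset F) :
    Module.finrank F (LinearMap.ker (aeval f (∏ c ∈ s, (X - C c)))) ≤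
      ∑ c ∈ s, Module.finrank F (f.eigenspace c) := by
  classical
  induction s using Finset.induction_on with
  | empty =>
    rw [Finset.prod_empty, map_one, Module.End.one_eq_id, LinearMap.ker_id, finrank_bot,
      Finset.sum_empty]
  | insert a s ha ih =>
    have coprime : IsCoprime (X - C a) (∏ c ∈ s, (X - C c)) :=
      IsCoprime.prod_right fun c hc => isCoprime_X_sub_C_of_isUnit_sub
        (sub_ne_zero.2 (ne_of_mem_of_not_mem hc ha).symm).isUnit
    have ker_eq : LinearMap.ker (aeval f (X - C a)) = f.eigenspace a := by
      rw [map_sub, aeval_X, aeval_C, Module.End.eigenspace_def, Algebra.algebraMap_eq_smul_one]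
    rw [Finset.prod_insert ha, Finset.sum_insert ha,
      ← sup_ker_aeval_eq_ker_aeval_mul_of_coprime f coprime, ker_eq]
    exact (Submodule.finrank_add_le_finrank_add_finrank _ _).trans (Nat.add_le_add_left ih _)

theorem finrank_eq_natDegree_minpoly {f : Module.End F V} (splits : (minpoly F f).Splits)
    (separable : (minpoly F f).Separable)
    (finrank_le : ∀ c, Module.finrank F (f.eigenspace c) ≤ 1) :
    Module.finrank F V = (minpoly F f).natDegree := by
  apply le_antisymm
  · let roots : Finset F := ⟨(minpoly F f).roots, nodup_roots separable⟩
    have minpoly_eq : minpoly F f = ∏ c ∈ roots, (X - C c) :=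
      splits.eq_prod_roots_of_monic (minpoly.monic (Algebra.IsIntegral.isIntegral f))
    calc Module.finrank F V
        = Module.finrank F (LinearMap.ker (aeval f (∏ c ∈ roots, (X - C c)))) := by
          rw [← minpoly_eq, minpoly.aeval, LinearMap.ker_zero, finrank_top]
      _ ≤ ∑ c ∈ roots, Module.finrank F (f.eigenspace c) :=
          finrank_ker_aeval_prod_X_sub_C_le f roots
      _ ≤ roots.card := by simpa using Finset.sum_le_card_nsmul roots _ 1 fun c _ => finrank_le c
      _ ≤ (minpoly F f).natDegree := card_roots' _
  · rw [← LinearMap.charpoly_natDegree f]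
    exact natDegree_le_of_dvd (LinearMap.minpoly_dvd_charpoly f) f.charpoly_monic.ne_zero

theorem splits_X_pow_char_sub_X (F : Type*) [Field F] (p : ℕ) [Fact p.Prime] [CharP F p] :
    (X ^ p - X : F[X]).Splits := by
  simpa using (GaloisField.splits_zmod_X_pow_sub_X p).map (ZMod.castHom dvd_rfl F)

end Eigenspaces

section Constants

variable {F E : Type*} [Field F] [Field E] [Algebra F E]

theorem finrank_eigenspace_derivation_le_one (δ : Derivation F E E)
    (hconst : ∀ a : E, δ a = 0 → a ∈ (algebraMap F E).range) (c : F) :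
    Module.finrank F (Module.End.eigenspace (δ : E →ₗ[F] E) c) ≤ 1 := by
  rcases subsingleton_or_nontrivial (Module.End.eigenspace (δ : E →ₗ[F] E) c) with _ | _
  · rw [Module.finrank_zero_of_subsingleton]
    exact zero_le_one
  · obtain ⟨⟨y, hy⟩, y_ne_zero⟩ := exists_ne (0 : Module.End.eigenspace (δ : E →ₗ[F] E) c)
    replace y_ne_zero : y ≠ 0 := fun h => y_ne_zero (Subtype.ext h)
    refine finrank_le_one ⟨y, hy⟩ fun ⟨x, hx⟩ => ?_
    have hδx : δ x = c • x := Module.End.mem_eigenspace_iff.1 hx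
    have hδy : δ y = c • y := Module.End.mem_eigenspace_iff.1 hy
    have div_const : δ (x / y) = 0 := by
      rw [δ.leibniz_div, hδx, hδy, smul_comm y c x, smul_comm x c y, smul_eq_mul x y, mul_comm x y,
        smul_eq_mul y x, sub_self, smul_zero]
    obtain ⟨k, hk⟩ := hconst _ div_const
    refine ⟨k, Subtype.ext ?_⟩
    change k • y = x
    rw [Algebra.smul_def, hk, div_mul_cancel₀ x y_ne_zero]

open Polynomial in
theorem finrank_eq_of_minpoly_derivation_eq [FiniteDimensional F E] (p : ℕ) [hp : Fact p.Prime]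
    [CharP F p] (δ : Derivation F E E)
    (hconst : ∀ a : E, δ a = 0 → a ∈ (algebraMap F E).range)
    (hmin : minpoly F (δ.toLinearMap : Module.End F E) = X ^ p - X) :
    Module.finrank F E = p := by
  rw [finrank_eq_natDegree_minpoly (hmin ▸ splits_X_pow_char_sub_X F p)
      (hmin ▸ galois_poly_separable p p dvd_rfl) (finrank_eigenspace_derivation_le_one δ hconst),
    hmin, FiniteField.X_pow_card_sub_X_natDegree_eq F hp.out.one_lt]

end Constants

end

theorem mainTheorem4_general {F E D : Type*} [Field F] [CommRing E] [Algebra F E]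
    [FiniteDimensional F E] [Ring D] [Algebra F D] [FiniteDimensional F D]
    (p : ℕ) [Fact p.Prime] [CharP F p] (δ : Derivation F E E)
    (hDE : IsDivisionAlgebra (D ⊗[F] E)) (d : E) :
    Module.finrank F (DiffExt δ.toNC p d ⊗[F] D) =
      p * Module.finrank F E * Module.finrank F D ∧
    (IsDivisionAlgebra (DiffExt δ.toNC p d ⊗[F] D) ↔
      ∀ z : D ⊗[F] E, (1 : D) ⊗ₜ[F] d ≠ DiffPoly.V (δ.extendNC D) p z - z) ∧
    ((∀ z : D ⊗[F] E, (1 : D) ⊗ₜ[F] d ≠ DiffPoly.V (δ.extendNC D) p z - z) ↔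
      ∀ z : D ⊗[F] E, DiffPoly.C (δ.extendNC D) ((1 : D) ⊗ₜ[F] d) ≠
        DiffPoly.t (δ.extendNC D) ^ p -
          (DiffPoly.t (δ.extendNC D) - DiffPoly.C (δ.extendNC D) z) ^ p -
            DiffPoly.C (δ.extendNC D) z) ∧
    ∃ φ : (DiffExt δ.toNC p d ⊗[F] D) ≃ₗ[F] DiffExt (δ.extendNC D) p ((1 : D) ⊗ₜ[F] d),
      (∀ x y, φ (x * y) = φ x * φ y) ∧
      (∀ (a : E) (i : ℕ) (b : D), i < p →
        φ (PetitAlgebra.mk _ _ (DiffPoly.C δ.toNC a * DiffPoly.t δ.toNC ^ i) ⊗ₜ[F] b) =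
          PetitAlgebra.mk _ _
            (DiffPoly.C (δ.extendNC D) (b ⊗ₜ[F] a) * DiffPoly.t (δ.extendNC D) ^ i)) ∧
      ∃ G ∈ NAAut F (DiffExt δ.toNC p d ⊗[F] D),
        (∀ x, (φ (G x)).rep = DiffPoly.shift (-1) (φ x).rep) ∧
        (∀ b : D, G (1 ⊗ₜ[F] b) = 1 ⊗ₜ[F] b) ∧
        Nat.card (Subgroup.zpowers G) = p := by
  have := hDE.1
  have : Nontrivial E := (Algebra.TensorProduct.includeRight : E →ₐ[F] D ⊗[F] E).domain_nontrivial
  let φ := DiffExt.tensorEquiv D δ p d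
  refine ⟨?_, ?_, ?_, φ, DiffExt.tensorEquiv_mul,
    fun a i b _ => DiffExt.tensorEquiv_monomial a i b, DiffExt.tensorTranslate D δ p d,
    DiffExt.tensorTranslate_mem_NAAut, DiffExt.rep_tensorEquiv_tensorTranslate,
    DiffExt.tensorTranslate_one_tmul, ?_⟩
  · rw [Module.finrank_tensorProduct, DiffExt.finrank_eq]
  · rw [IsDivisionAlgebra.congr ⟨φ.toEquiv, DiffExt.tensorEquiv_mul⟩]
    exact DiffExt.isDivisionAlgebra_iff hDE (δ.extendNC D) p _
  · simp only [ne_eq, DiffPoly.eq_V_sub_iff]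
  · rw [Nat.card_zpowers, DiffExt.orderOf_tensorTranslate]

theorem mainTheorem4 {F E D : Type*} [Field F] [Field E] [Algebra F E] [FiniteDimensional F E]
    [DivisionRing D] [Algebra F D] [Algebra.IsCentral F D] [FiniteDimensional F D]
    (p : ℕ) [Fact p.Prime] [CharP F p]
    [IsPurelyInseparable.HasExponent F E] (hexp : IsPurelyInseparable.exponent F E = 1)
    (δ : Derivation F E E)
    (hconst : ∀ a : E, δ a = 0 ↔ a ∈ (algebraMap F E).range)
    (hmin : minpoly F (δ.toLinearMap : Module.End F E) =
      (Polynomial.X ^ p - Polynomial.X : Polynomial F))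
    (hDE : IsDivisionAlgebra (D ⊗[F] E)) (d : E) :
    -- the tensor product has dimension `p² [D : F]`
    Module.finrank F (DiffExt δ.toNC p d ⊗[F] D) = p ^ 2 * Module.finrank F D ∧
    -- it is a division algebra if and only if `d ≠ V_p(z) - z` for all `z`
    (IsDivisionAlgebra (DiffExt δ.toNC p d ⊗[F] D) ↔
      ∀ z : D ⊗[F] E, (1 : D) ⊗ₜ[F] d ≠ DiffPoly.V (δ.extendNC D) p z - z) ∧
    -- equivalently, `d ≠ tᵖ - (t - z)ᵖ - z` for all `z`
    ((∀ z : D ⊗[F] E, (1 : D) ⊗ₜ[F] d ≠ DiffPoly.V (δ.extendNC D) p z - z) ↔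
      ∀ z : D ⊗[F] E, DiffPoly.C (δ.extendNC D) ((1 : D) ⊗ₜ[F] d) ≠
        DiffPoly.t (δ.extendNC D) ^ p -
          (DiffPoly.t (δ.extendNC D) - DiffPoly.C (δ.extendNC D) z) ^ p -
            DiffPoly.C (δ.extendNC D) z) ∧
    -- the canonical isomorphism with `D_E[t;δ]/D_E[t;δ](tᵖ - t - d)`
    ∃ φ : (DiffExt δ.toNC p d ⊗[F] D) ≃ₗ[F] DiffExt (δ.extendNC D) p ((1 : D) ⊗ₜ[F] d),
      (∀ x y, φ (x * y) = φ x * φ y) ∧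
      (∀ (a : E) (i : ℕ) (b : D), i < p →
        φ (PetitAlgebra.mk _ _ (DiffPoly.C δ.toNC a * DiffPoly.t δ.toNC ^ i) ⊗ₜ[F] b) =
          PetitAlgebra.mk _ _
            (DiffPoly.C (δ.extendNC D) (b ⊗ₜ[F] a) * DiffPoly.t (δ.extendNC D) ^ i)) ∧
      -- `G_{id,-1}` is an automorphism which is the identity on `D` and generates a cyclic
      -- subgroup of order `p`
      ∃ G ∈ NAAut F (DiffExt δ.toNC p d ⊗[F] D),
        (∀ x, (φ (G x)).rep = DiffPoly.shift (-1) (φ x).rep) ∧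
        (∀ b : D, G (1 ⊗ₜ[F] b) = 1 ⊗ₜ[F] b) ∧
        Nat.card (Subgroup.zpowers G) = p := by
  simpa only [finrank_eq_of_minpoly_derivation_eq p δ (fun a => (hconst a).1) hmin, ← sq] using
    mainTheorem4_general p δ hDE d
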